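/- Let $P=\{p_v : v\in V\}$ be a finite set of $n\ge 2$ distinct points in the Euclidean plane, no three of them collinear. A graph $G$ with vertex set $V$, whose edges $ij$ are drawn as straight segments $p_ip_j$, is a *pseudo-triangulation of $P$* if it is connected, any two disjoint edges are drawn as disjoint closed segments, the boundary of the convex hull of $P$ is covered by the edges of $G$, and every bounded face (bounded connected component of the complement of the drawing) is a pseudo-triangle, that is, the interior of a simple polygon (whose vertices and sides are vertices and edges of $G$) with exactly three convex vertices (interior angle strictly smaller than $\pi$). It is *pointed* if at every vertex some two consecutive edges (in the cyclic order around the vertex) span an angle larger than $\pi$. An *infinitesimal motion* of the framework $G(P)$ is a family of vectors $u_v\in\mathbb R^2$ with $\langle p_i-p_j,u_i-u_j\rangle=0$ for all edges $ij$ of $G$. It is *trivial* if it is the sum of an infinitesimal translation and an infinitesimal rotation. The framework is *infinitesimally rigid* if all its infinitesimal motions are trivial, and *minimally infinitesimally rigid* if moreover the removal of any edge destroys infinitesimal rigidity. It is *rigid* if $G$ has an edge and, for every edge $ab$ of $G$, the realization $P$ is an isolated point of the set of all realizations $(q_v)_{v\in V}$ of $G$ with the same edge lengths as $G(P)$ and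 with $q_a=p_a$, $q_b=p_b$. **Theorem.** Every pseudo-triangulation of $P$ is infinitesimally rigid, and hence also rigid. If it is pointed, then it is minimally infinitesimally rigid. -/

import Mathlib

open Set Filter Topology

/-! The Euclidean plane is `ℂ` (with its Euclidean norm and real inner product).
A geometric graph, or framework, is a graph `G` on a vertex set `V` together with a map
`p : V → ℂ`; each edge `ij` is drawn as the straight segment from `p i` to `p j`. -/

namespace PlaneFramework

/-! ### Simple polygons and pseudo-triangles -/

/-- A closed polygon is simple if its vertices are distinct and two different sides meet at most
in a common endpoint. -/
def IsSimplePolygon {k : ℕ} (c : Polygon ℂ k) : Prop :=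
  3 ≤ k ∧ Function.Injective c.vertices ∧
    ∀ i j : Fin k, i ≠ j →
      c.edgeSet ℝ i ∩ c.edgeSet ℝ j ⊆ {c i, c (finRotate k i)} ∩ {c j, c (finRotate k j)}

/-- The interior region of a closed polygon: the points off the polygonal curve that lie in a
bounded connected component of the complement of that curve. -/
def polygonInterior {k : ℕ} (c : Polygon ℂ k) : Set ℂ :=
  {x | x ∉ c.boundary ℝ ∧ Bornology.IsBounded (connectedComponentIn (c.boundary ℝ)ᶜ x)}

/-- The vertex `c i` is convex (a corner): the angle facing the interior is strictly smaller
than `π`. That is, the two incident sides are not aligned, and near `c i` the convex open sector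
which they span belongs to the interior. -/
def IsConvexVertex {k : ℕ} (c : Polygon ℂ k) (i : Fin k) : Prop :=
  ¬ Collinear ℝ {c ((finRotate k).symm i), c i, c (finRotate k i)} ∧
    ∃ ε : ℝ, 0 < ε ∧ ∀ s t : ℝ, 0 < s → s < ε → 0 < t → t < ε →
      c i + s • (c ((finRotate k).symm i) - c i) + t • (c (finRotate k i) - c i) ∈
        polygonInterior c

/-- A pseudo-triangle is a simple polygon with exactly three convex vertices. -/
def IsPseudoTriangle {k : ℕ} (c : Polygon ℂ k) : Prop :=
  IsSimplePolygon c ∧ {i : Fin k | IsConvexVertex c i}.ncard = 3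

/-! ### Geometric graphs -/

variable {V : Type*}

/-- The points `p i` are distinct and no three of them are collinear. -/
def InGeneralPosition (p : V → ℂ) : Prop :=
  Function.Injective p ∧
    ∀ i j k : V, i ≠ j → j ≠ k → i ≠ k → ¬ Collinear ℝ {p i, p j, p k}

/-- The subset of the plane covered by the vertices and the edges. -/
def drawing (G : SimpleGraph V) (p : V → ℂ) : Set ℂ :=
  range p ∪ {x | ∃ i j : V, G.Adj i j ∧ x ∈ segment ℝ (p i) (p j)}

/-- Any two disjoint edges are drawn as disjoint closed segments. -/
def IsNonCrossing (G : SimpleGraph V) (p : V → ℂ) : Prop :=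
  ∀ i j k l : V, G.Adj i j → G.Adj k l → i ≠ k → i ≠ l → j ≠ k → j ≠ l →
    Disjoint (segment ℝ (p i) (p j)) (segment ℝ (p k) (p l))

/-- The faces are the connected components of the complement of the drawing. -/
def IsFace (G : SimpleGraph V) (p : V → ℂ) (F : Set ℂ) : Prop :=
  ∃ x ∈ (drawing G p)ᶜ, F = connectedComponentIn (drawing G p)ᶜ x

/-- The region `F` is the interior of a pseudo-triangle whose vertices and sides are vertices and
edges of the geometric graph. -/
def IsPseudoTriangularRegion (G : SimpleGraph V) (p : V → ℂ) (F : Set ℂ) : Prop :=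
  ∃ (k : ℕ) (w : Fin k → V), (∀ i : Fin k, G.Adj (w i) (w (finRotate k i))) ∧
    IsPseudoTriangle (Polygon.mk (p ∘ w)) ∧ F = polygonInterior (Polygon.mk (p ∘ w))

/-- A pseudo-triangulation of the point set `p` : a connected non-crossing geometric graph on all
the points, which contains the boundary of their convex hull and all of whose bounded faces are
pseudo-triangles. -/
structure IsPseudoTriangulation (G : SimpleGraph V) (p : V → ℂ) : Prop where
  nonCrossing : IsNonCrossing G p
  connected : G.Connected
  hull_boundary : frontier (convexHull ℝ (range p)) ⊆ drawing G p
  bounded_face : ∀ F : Set ℂ, IsFace G p F → Bornology.IsBounded F →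
    IsPseudoTriangularRegion G p F

/-! ### Pointedness -/

/-- The angle in `(0, 2π]` by which the direction of `x` has to be turned counterclockwise to
reach the direction of `y` ; it is `2π` if the directions agree. -/
noncomputable def ccwAngle (x y : ℂ) : ℝ :=
  toIocMod Real.two_pi_pos 0 (Complex.arg (y / x))

/-- The edges `vi` and `vj` are consecutive in the counterclockwise cyclic order around `v`.
For a vertex of degree one, its only edge is consecutive to itself, and spans the angle `2π`. -/
def AreConsecutive (G : SimpleGraph V) (p : V → ℂ) (v i j : V) : Prop :=
  G.Adj v i ∧ G.Adj v j ∧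
    ∀ k : V, G.Adj v k → ccwAngle (p i - p v) (p j - p v) ≤ ccwAngle (p i - p v) (p k - p v)

/-- Some pair of consecutive edges around `v` spans an angle larger than `π`. -/
def IsPointedAt (G : SimpleGraph V) (p : V → ℂ) (v : V) : Prop :=
  ∃ i j : V, AreConsecutive G p v i j ∧ Real.pi < ccwAngle (p i - p v) (p j - p v)

/-! ### Rigidity -/

/-- The velocities `u` preserve all edge lengths to first order. -/
def IsInfinitesimalMotion (G : SimpleGraph V) (p u : V → ℂ) : Prop :=
  ∀ i j : V, G.Adj i j → inner ℝ (p i - p j) (u i - u j) = 0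

/-- A trivial motion: an infinitesimal translation plus an infinitesimal rotation (which sends a
point `z` to the velocity `r * i * z`, a real multiple of `z` turned by a right angle). -/
def IsTrivialMotion (p u : V → ℂ) : Prop :=
  ∃ (a : ℂ) (r : ℝ), ∀ i : V, u i = a + r * Complex.I * p i

/-- There are no infinitesimal motions other than the trivial ones. -/
def IsInfinitesimallyRigid (G : SimpleGraph V) (p : V → ℂ) : Prop :=
  ∀ u : V → ℂ, IsInfinitesimalMotion G p u → IsTrivialMotion p u

/-- The framework is infinitesimally rigid, and no longer so after the removal of any edge. -/
def IsMinimallyInfinitesimallyRigid (G : SimpleGraph V) (p : V → ℂ) : Prop :=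
  IsInfinitesimallyRigid G p ∧
    ∀ e ∈ G.edgeSet, ¬ IsInfinitesimallyRigid (G.deleteEdges {e}) p

/-- The realizations of `G` that have the same edge lengths as `p`. -/
def configurationSpace (G : SimpleGraph V) (p : V → ℂ) : Set (V → ℂ) :=
  {q | ∀ i j : V, G.Adj i j → dist (q i) (q j) = dist (p i) (p j)}

/-- The realizations in the configuration space in which `a` and `b` are pinned down. -/
def pinnedConfigurationSpace (G : SimpleGraph V) (p : V → ℂ) (a b : V) : Set (V → ℂ) :=
  {q | q ∈ configurationSpace G p ∧ q a = p a ∧ q b = p b}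

/-- The framework is rigid: it has an edge, and whichever edge is pinned down, `p` is an isolated
point of the pinned configuration space. -/
def IsRigid (G : SimpleGraph V) (p : V → ℂ) : Prop :=
  (∃ a b : V, G.Adj a b) ∧
    ∀ a b : V, G.Adj a b → ∀ᶠ q in 𝓝 p, q ∈ pinnedConfigurationSpace G p a b → q = p

end PlaneFramework

namespace PlaneFramework

/-! ### Cross products and counterclockwise angles -/

/-! Turning velocities by a right angle changes an infinitesimal motion into a parallel motion `w`:
on each edge `w j - w i` is parallel to `p j - p i`. Trivial motions become translations plus
dilations, so the task is to show that every parallel motion has this form.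

The engine is a count of sectors, the angles between consecutive edges, indexed by darts. Let `n`,
`e`, `f` be the numbers of vertices, edges and bounded faces, `ρ` the number of reflex sectors, and
`κ` the number of sectors counted with respect to a transversal field `u` (`IsTransversal`,
`IsCounted`). Four facts hold. Each bounded face contains an odd number of counted sectors, because
it has three corners (`odd_card_counted`). Each of `u v` and `-u v` lies in at most one sector at
`v`, whence `κ + ρ ≤ 2n` (`card_counted_add_card_reflex_le`). All convex sectors lie in bounded
faces, three in each, whence `3f + ρ = 2e` (`card_dart_eq`). Half of Euler's formula gives `f + n ≤
e + 1` (`card_boundedFace_add_card_le`). Together `κ ≤ f + 2`. So no transversal field has both a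
bounded face with two, hence three, counted sectors and a counted sector outside all bounded faces
(`false_of_isCounted`).

Suppose that for a hull vertex `i` and some `v` the vector `w i - w v` is not parallel to `p i - p
v`. Subtracting a translation and a suitable dilation from `w` gives a field that vanishes at `v`
and makes the outer sector at `i` counted. A small constant perturbation then makes two sectors of
one face at `v` counted, which is the forbidden configuration (`cross_eq_zero_of_hull`). Two hull
vertices related in this way to all other vertices determine `w` everywhere.

Rigidity follows from infinitesimal rigidity by averaging two realizations. For minimality,
infinitesimal rigidity needs `2n - 3` edges, while the same count with a constant field shows that a
pointed pseudo-triangulation has at most that many. That faces have only one side along each polygon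
edge, and are separated by their polygons, is obtained from winding numbers. -/

/-- The cross product of two vectors of the plane. -/
def cross (a b : ℂ) : ℝ := a.re * b.im - a.im * b.re

lemma cross_self (a : ℂ) : cross a a = 0 := by simp [cross]; ring
lemma cross_add (a b c : ℂ) : cross a (b + c) = cross a b + cross a c := by simp [cross]; ring
lemma cross_sub (a b c : ℂ) : cross a (b - c) = cross a b - cross a c := by simp [cross]; ring
lemma cross_neg (a b : ℂ) : cross a (-b) = -cross a b := by simp [cross]; ring
lemma neg_cross (a b : ℂ) : cross (-a) b = -cross a b := by simp [cross]; ring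
lemma cross_comm (a b : ℂ) : cross a b = -cross b a := by simp [cross]; ring
lemma cross_mul (a b : ℂ) (r : ℝ) : cross a (r * b) = r * cross a b := by simp [cross]; ring
lemma mul_cross (a b : ℂ) (r : ℝ) : cross (r * a) b = r * cross a b := by simp [cross]; ring
lemma add_cross (a b c : ℂ) : cross (a + b) c = cross a c + cross b c := by simp [cross]; ring
lemma cross_zero (a : ℂ) : cross a 0 = 0 := by simp [cross]
lemma zero_cross (a : ℂ) : cross 0 a = 0 := by simp [cross]
lemma cross_sub_comm (a b c : ℂ) : cross (a - b) c = -cross (b - a) c := by simp [cross]; ring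

lemma continuous_cross (a : ℂ) : Continuous (cross a) := by unfold cross; fun_prop

lemma eq_real_mul_of_cross_eq_zero {a b : ℂ} (ha : a ≠ 0) (h : cross a b = 0) :
    ∃ r : ℝ, b = r * a := by
  simp only [cross] at h
  by_cases h0 : a.re = 0
  · have h1 : a.im ≠ 0 := fun h1 => ha (Complex.ext h0 h1)
    refine ⟨b.im / a.im, Complex.ext ?_ ?_⟩
    · have : b.re = 0 := by
        rw [h0] at h; simpa [h1] using h
      simp [h0, this]
    · simp [h1]
  · refine ⟨b.re / a.re, Complex.ext ?_ ?_⟩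
    · simp [h0]
    · simp; field_simp; linarith

lemma eq_zero_of_cross_eq_zero {a b c : ℂ} (hab : cross a b ≠ 0) (ha : cross a c = 0)
    (hb : cross b c = 0) : c = 0 := by
  have ha0 : a ≠ 0 := by rintro rfl; simp [zero_cross] at hab
  obtain ⟨r, rfl⟩ := eq_real_mul_of_cross_eq_zero ha0 ha
  rw [cross_mul, cross_comm] at hb
  have : r = 0 := by
    rcases mul_eq_zero.1 hb with h | h
    · exact h
    · exact absurd (neg_eq_zero.1 h) hab
  simp [this]

lemma collinear_iff_cross (a b c : ℂ) : Collinear ℝ {a, b, c} ↔ cross (b - a) (c - a) = 0 := by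
  rw [collinear_iff_of_mem (p₀ := a) (by simp)]
  constructor
  · rintro ⟨v, h⟩
    obtain ⟨r, hr⟩ := h b (by simp)
    obtain ⟨s, hs⟩ := h c (by simp)
    rw [hr, hs]
    simp [cross]; ring
  · intro h
    by_cases hb : b - a = 0
    · refine ⟨c - a, ?_⟩
      intro x hx
      rcases hx with rfl | rfl | rfl
      · exact ⟨0, by simp⟩
      · exact ⟨0, by simpa [sub_eq_zero] using hb⟩
      · exact ⟨1, by simp⟩
    · obtain ⟨r, hr⟩ := eq_real_mul_of_cross_eq_zero hb h
      refine ⟨b - a, ?_⟩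
      intro x hx
      rcases hx with rfl | rfl | rfl
      · exact ⟨0, by simp⟩
      · exact ⟨1, by simp⟩
      · exact ⟨r, by simp [← hr]⟩

/-! ### Arithmetic of counterclockwise angles. -/

lemma ccwAngle_pos (x y : ℂ) : 0 < ccwAngle x y := left_lt_toIocMod _ _ _

lemma ccwAngle_le (x y : ℂ) : ccwAngle x y ≤ 2 * Real.pi :=
  (toIocMod_le_right Real.two_pi_pos 0 (Complex.arg (y / x))).trans_eq (zero_add _)

lemma ccwAngle_spec {x y : ℂ} (hx : x ≠ 0) (hy : y ≠ 0) :
    y = ((‖y‖ / ‖x‖ : ℝ) : ℂ) * Complex.exp (ccwAngle x y * Complex.I) * x := by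
  have h : Complex.exp (ccwAngle x y * Complex.I) = Complex.exp (Complex.arg (y / x) * Complex.I) := by
    rw [ccwAngle, ← self_sub_toIocDiv_zsmul]
    rw [Complex.exp_eq_exp_iff_exists_int]
    refine ⟨-toIocDiv Real.two_pi_pos 0 (Complex.arg (y / x)), ?_⟩
    push_cast [zsmul_eq_mul]; ring
  rw [h, ← norm_div, Complex.norm_mul_exp_arg_mul_I]
  field_simp

lemma ccwAngle_eq {x : ℂ} (hx : x ≠ 0) {r φ : ℝ} (hr : 0 < r) (h0 : 0 < φ)
    (h1 : φ ≤ 2 * Real.pi) : ccwAngle x (r * Complex.exp (φ * Complex.I) * x) = φ := by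
  rw [ccwAngle, mul_div_assoc, div_self hx, mul_one, Complex.exp_mul_I,
    Complex.arg_mul_cos_add_sin_mul_I_eq_toIocMod hr, toIocMod_toIocMod,
    toIocMod_eq_self]
  constructor <;> simp_all

lemma ccwAngle_mul_left {x y : ℂ} {r : ℝ} (hr : 0 < r) :
    ccwAngle x (r * y) = ccwAngle x y := by
  rw [ccwAngle, ccwAngle, mul_div_assoc, Complex.arg_real_mul _ hr]

lemma ccwAngle_self {x : ℂ} (hx : x ≠ 0) : ccwAngle x x = 2 * Real.pi := by
  have := ccwAngle_eq hx one_pos Real.two_pi_pos le_rfl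
  simpa using this

lemma eq_mul_of_ccwAngle_eq {x y z : ℂ} (hx : x ≠ 0) (hy : y ≠ 0) (hz : z ≠ 0)
    (h : ccwAngle x y = ccwAngle x z) : ∃ r : ℝ, 0 < r ∧ z = r * y := by
  refine ⟨‖z‖ / ‖y‖, by positivity, ?_⟩
  have h1 := ccwAngle_spec hx hz
  have h2 := ccwAngle_spec hx hy
  rw [← h] at h1
  generalize ccwAngle x y = α at *
  have hy' : (‖y‖ : ℂ) ≠ 0 := by simpa using hy
  calc z = ((‖z‖ / ‖x‖ : ℝ) : ℂ) * Complex.exp (α * Complex.I) * x := h1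
    _ = ((‖z‖ / ‖y‖ : ℝ) : ℂ) *
        (((‖y‖ / ‖x‖ : ℝ) : ℂ) * Complex.exp (α * Complex.I) * x) := by
      push_cast; field_simp
    _ = _ := by rw [← h2]

/-- Angles subtract without reduction modulo `2π` when `y` comes strictly before `z` in the turn
that starts at `x`. Comparisons of sectors below rest on this. -/
lemma ccwAngle_sub {x y z : ℂ} (hx : x ≠ 0) (hy : y ≠ 0) (hz : z ≠ 0)
    (h : ccwAngle x y < ccwAngle x z) : ccwAngle y z = ccwAngle x z - ccwAngle x y := by
  have e : z = ((‖z‖ / ‖y‖ : ℝ) : ℂ) *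
      Complex.exp ((ccwAngle x z - ccwAngle x y : ℝ) * Complex.I) * y := by
    have h1 := ccwAngle_spec hx hz
    have h2 := ccwAngle_spec hx hy
    generalize ccwAngle x z = α at *
    generalize ccwAngle x y = β at *
    have h3 : Complex.exp (((α - β : ℝ) : ℂ) * Complex.I) * Complex.exp (β * Complex.I) =
        Complex.exp (α * Complex.I) := by
      rw [← Complex.exp_add]; push_cast; ring_nf
    have hy' : (‖y‖ : ℂ) ≠ 0 := by simpa using hy
    calc z = ((‖z‖ / ‖x‖ : ℝ) : ℂ) * Complex.exp (α * Complex.I) * x := h1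
      _ = ((‖z‖ / ‖y‖ : ℝ) : ℂ) * Complex.exp (((α - β : ℝ) : ℂ) * Complex.I) *
          (((‖y‖ / ‖x‖ : ℝ) : ℂ) * Complex.exp (β * Complex.I) * x) := by
        rw [← h3]; push_cast; field_simp
      _ = _ := by rw [← h2]
  have := ccwAngle_pos x y
  have := ccwAngle_le x z
  conv_lhs => rw [e]
  exact ccwAngle_eq hy (by positivity) (by linarith) (by linarith)

lemma ccwAngle_swap {x y : ℂ} (hx : x ≠ 0) (hy : y ≠ 0) (h : ccwAngle x y < 2 * Real.pi) :
    ccwAngle y x = 2 * Real.pi - ccwAngle x y := by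
  rw [← ccwAngle_self hx] at h ⊢
  exact ccwAngle_sub hx hy hx h

lemma cross_eq_sin (x : ℂ) {y : ℂ} (hx : x ≠ 0) (hy : y ≠ 0) :
    cross x y = ‖x‖ * ‖y‖ * Real.sin (ccwAngle x y) := by
  have h := ccwAngle_spec hx hy
  generalize ccwAngle x y = α at *
  have h2 : cross x (Complex.exp (α * Complex.I) * x) = ‖x‖ ^ 2 * Real.sin α := by
    rw [Complex.exp_mul_I]
    simp only [cross, Complex.mul_re, Complex.mul_im, Complex.add_re, Complex.add_im,
      Complex.I_re, Complex.I_im, Complex.cos_ofReal_re, Complex.cos_ofReal_im,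
      Complex.sin_ofReal_re, Complex.sin_ofReal_im, Complex.sq_norm, Complex.normSq_apply]
    ring
  have hx' : ‖x‖ ≠ 0 := by simpa using hx
  conv_lhs => rw [h, mul_assoc, cross_mul, h2]
  field_simp

lemma sin_pos_iff_lt_pi {φ : ℝ} (h0 : 0 < φ) (h2 : φ ≤ 2 * Real.pi) :
    0 < Real.sin φ ↔ φ < Real.pi := by
  constructor
  · intro h
    by_contra h'
    push Not at h'
    have : 0 ≤ Real.sin (φ - Real.pi) :=
      Real.sin_nonneg_of_nonneg_of_le_pi (by linarith) (by linarith)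
    rw [Real.sin_sub_pi] at this
    linarith
  · exact fun h => Real.sin_pos_of_pos_of_lt_pi h0 h

lemma cross_pos_iff {x y : ℂ} (hx : x ≠ 0) (hy : y ≠ 0) :
    0 < cross x y ↔ ccwAngle x y < Real.pi := by
  rw [cross_eq_sin x hx hy, ← sin_pos_iff_lt_pi (ccwAngle_pos _ _) (ccwAngle_le _ _)]
  have : 0 < ‖x‖ * ‖y‖ := by positivity
  exact mul_pos_iff_of_pos_left this

lemma cross_neg_iff {x y : ℂ} (hx : x ≠ 0) (hy : y ≠ 0) :
    cross x y < 0 ↔ Real.pi < ccwAngle x y ∧ ccwAngle x y < 2 * Real.pi := by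
  constructor
  · intro h
    have h2 : ccwAngle x y ≠ 2 * Real.pi := by
      intro h'
      rw [cross_eq_sin x hx hy, h', Real.sin_two_pi, mul_zero] at h
      exact lt_irrefl _ h
    have h1 : ccwAngle x y ≠ Real.pi := by
      intro h'
      rw [cross_eq_sin x hx hy, h', Real.sin_pi, mul_zero] at h
      exact lt_irrefl _ h
    refine ⟨lt_of_le_of_ne ?_ h1.symm, lt_of_le_of_ne (ccwAngle_le _ _) h2⟩
    by_contra h'
    push Not at h'
    exact absurd ((cross_pos_iff hx hy).2 h') (by linarith)
  · rintro ⟨h1, h2⟩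
    rw [cross_comm, neg_lt_zero, cross_pos_iff hy hx, ccwAngle_swap hx hy h2]
    linarith

lemma ccwAngle_neg {x y : ℂ} (hx : x ≠ 0) (hy : y ≠ 0) :
    (ccwAngle x y ≤ Real.pi ∧ ccwAngle x (-y) = ccwAngle x y + Real.pi) ∨
      (Real.pi < ccwAngle x y ∧ ccwAngle x (-y) = ccwAngle x y - Real.pi) := by
  have h := ccwAngle_spec hx hy
  have h0 := ccwAngle_pos x y
  have h2 := ccwAngle_le x y
  generalize ccwAngle x y = α at *
  have hr : 0 < ‖y‖ / ‖x‖ := by positivity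
  rcases le_or_gt α Real.pi with h1 | h1
  · left
    refine ⟨h1, ?_⟩
    have e : -y = ((‖y‖ / ‖x‖ : ℝ) : ℂ) * Complex.exp ((α + Real.pi : ℝ) * Complex.I) * x := by
      conv_lhs => rw [h]
      push_cast
      rw [add_mul, Complex.exp_add, Complex.exp_pi_mul_I]; ring
    conv_lhs => rw [e]
    exact ccwAngle_eq hx hr (by linarith) (by linarith)
  · right
    refine ⟨h1, ?_⟩
    have e : -y = ((‖y‖ / ‖x‖ : ℝ) : ℂ) * Complex.exp ((α - Real.pi : ℝ) * Complex.I) * x := by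
      conv_lhs => rw [h]
      push_cast
      rw [sub_mul, Complex.exp_sub, Complex.exp_pi_mul_I]; ring
    conv_lhs => rw [e]
    exact ccwAngle_eq hx hr (by linarith) (by linarith)

end PlaneFramework

namespace PlaneFramework

/-! ### Winding numbers of closed polygons -/

/-- The total angle by which a closed polygon turns around a point. -/
noncomputable def winding {k : ℕ} (c : Polygon ℂ k) (x : ℂ) : ℝ :=
  ∑ m, Complex.arg ((c (finRotate k m) - x) / (c m - x))

lemma edgeSet_eq_segment {k : ℕ} (c : Polygon ℂ k) (m : Fin k) :
    c.edgeSet ℝ m = segment ℝ (c m) (c (finRotate k m)) := affineSegment_eq_segment ℝ _ _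

lemma isClosed_segment (a b : ℂ) : IsClosed (segment ℝ a b) := by
  rw [segment_eq_image_lineMap]
  exact (isCompact_Icc.image (by fun_prop)).isClosed

lemma isClosed_boundary {k : ℕ} (c : Polygon ℂ k) : IsClosed (c.boundary ℝ) := by
  unfold Polygon.boundary
  refine isClosed_iUnion_of_finite fun m => ?_
  rw [edgeSet_eq_segment]
  exact isClosed_segment _ _

lemma div_mem_slitPlane {a b x : ℂ} (h : x ∉ segment ℝ a b) :
    (b - x) / (a - x) ∈ Complex.slitPlane := by
  by_contra hn
  rw [Complex.mem_slitPlane_iff] at hn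
  push Not at hn
  obtain ⟨h1, h2⟩ := hn
  have hax : a - x ≠ 0 := by
    intro h0
    rw [sub_eq_zero] at h0
    exact h (h0 ▸ left_mem_segment ℝ a b)
  set r := -((b - x) / (a - x)).re with hr
  have hr0 : 0 ≤ r := by linarith
  have e : (b - x) / (a - x) = -(r : ℂ) := by
    apply Complex.ext <;> simp [hr, h2]
  rw [div_eq_iff hax] at e
  apply h
  -- Solving `b - x = -r (a - x)` gives `x = (r a + b) / (1 + r)`, a point of the segment.
  refine ⟨r / (1 + r), 1 / (1 + r), by positivity, by positivity, by field_simp; ring, ?_⟩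
  have h3 : (1 + (r : ℂ)) ≠ 0 := by
    have : (1 + r) ≠ 0 := by positivity
    exact_mod_cast this
  simp only [Complex.real_smul]
  push_cast
  field_simp
  linear_combination e

lemma continuousAt_arg_div {a b x : ℂ} (h : x ∉ segment ℝ a b) :
    ContinuousAt (fun x => Complex.arg ((b - x) / (a - x))) x := by
  have hax : a - x ≠ 0 := by
    intro h0
    rw [sub_eq_zero] at h0
    exact h (h0 ▸ left_mem_segment ℝ a b)
  have : ContinuousAt (fun x => (b - x) / (a - x)) x := by fun_prop (disch := assumption)
  exact ContinuousAt.comp (g := Complex.arg) (f := fun x => (b - x) / (a - x))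
    (Complex.continuousAt_arg (div_mem_slitPlane h)) this

lemma notMem_edgeSet {k : ℕ} {c : Polygon ℂ k} {x : ℂ} (hx : x ∉ c.boundary ℝ) (m : Fin k) :
    x ∉ segment ℝ (c m) (c (finRotate k m)) := by
  rw [← edgeSet_eq_segment]
  exact fun h => hx (mem_iUnion.2 ⟨m, h⟩)

lemma continuousAt_winding {k : ℕ} {c : Polygon ℂ k} {x : ℂ} (hx : x ∉ c.boundary ℝ) :
    ContinuousAt (winding c) x :=
  tendsto_finsetSum _ fun m _ => continuousAt_arg_div (notMem_edgeSet hx m)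

/-- The exponentials of the turning angles are quotients of the unit vectors from `x` to successive
vertices, so their product around the polygon is `1`. -/
lemma exists_winding_eq_int {k : ℕ} {c : Polygon ℂ k} {x : ℂ} (hx : x ∉ c.boundary ℝ) :
    ∃ n : ℤ, winding c x = n * (2 * Real.pi) := by
  have hne : ∀ m, c m - x ≠ 0 := by
    intro m h0
    rw [sub_eq_zero] at h0
    exact notMem_edgeSet hx m (h0 ▸ left_mem_segment ℝ _ _)
  have h1 : Complex.exp (winding c x * Complex.I) = 1 := by
    have h2 : ∀ m, Complex.exp (Complex.arg ((c (finRotate k m) - x) / (c m - x)) * Complex.I) =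
        ((c (finRotate k m) - x) / (‖c (finRotate k m) - x‖ : ℂ)) /
          ((c m - x) / (‖c m - x‖ : ℂ)) := by
      intro m
      have h3 := Complex.norm_mul_exp_arg_mul_I ((c (finRotate k m) - x) / (c m - x))
      rw [norm_div] at h3
      have h4 : (‖c m - x‖ : ℂ) ≠ 0 := by simpa using hne m
      have h5 : (‖c (finRotate k m) - x‖ : ℂ) ≠ 0 := by simpa using hne (finRotate k m)
      have h6 := hne m
      generalize Complex.exp _ = E at *
      push_cast at h3
      field_simp at h3 ⊢
      linear_combination h3
    rw [winding]
    push_cast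
    rw [Finset.sum_mul, Complex.exp_sum, Finset.prod_congr rfl fun m _ => h2 m,
      Finset.prod_div_distrib,
      Equiv.prod_comp (finRotate k) fun m => (c m - x) / (‖c m - x‖ : ℂ)]
    apply div_self
    rw [Finset.prod_ne_zero_iff]
    intro m _
    have h4 : (‖c m - x‖ : ℂ) ≠ 0 := by simpa using hne m
    exact div_ne_zero (hne m) h4
  rw [Complex.exp_eq_one_iff] at h1
  obtain ⟨n, hn⟩ := h1
  refine ⟨n, ?_⟩
  have : (winding c x : ℂ) * Complex.I = ((n * (2 * Real.pi) : ℝ) : ℂ) * Complex.I := by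
    rw [hn]; push_cast; ring
  exact_mod_cast mul_right_cancel₀ Complex.I_ne_zero this

/-- A continuous function with values in `2πℤ` is constant on a connected set: two different values
would force a half-integral multiple of `2π` in between. -/
lemma winding_eq_of_isPreconnected {k : ℕ} {c : Polygon ℂ k} {S : Set ℂ} (hS : IsPreconnected S)
    (hc : S ⊆ (c.boundary ℝ)ᶜ) {x y : ℂ} (hx : x ∈ S) (hy : y ∈ S) :
    winding c x = winding c y := by
  by_contra hne
  wlog hlt : winding c x < winding c y generalizing x y
  · exact this hy hx (Ne.symm hne) (lt_of_le_of_ne (not_lt.1 hlt) (Ne.symm hne))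
  obtain ⟨n, hn⟩ := exists_winding_eq_int (hc hx)
  obtain ⟨m, hm⟩ := exists_winding_eq_int (hc hy)
  have hpi := Real.pi_pos
  have hcont : ContinuousOn (winding c) S := fun z hz =>
    (continuousAt_winding (hc hz)).continuousWithinAt
  have hnm : (n : ℝ) + 1 ≤ m := by
    rw [hn, hm] at hlt
    have h3 : (n : ℝ) < m := lt_of_mul_lt_mul_right hlt (by positivity)
    have : n < m := by exact_mod_cast h3
    exact_mod_cast this
  have hmem : ((n : ℝ) + 1 / 2) * (2 * Real.pi) ∈ Icc (winding c x) (winding c y) := by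
    rw [hn, hm]
    constructor <;> apply mul_le_mul_of_nonneg_right _ (by positivity) <;> linarith
  obtain ⟨z, hz, hzw⟩ := hS.intermediate_value hx hy hcont hmem
  obtain ⟨l, hl⟩ := exists_winding_eq_int (hc hz)
  rw [hl] at hzw
  have h4 : (l : ℝ) = n + 1 / 2 := mul_right_cancel₀ (by positivity) hzw
  have h5 : ((2 * l : ℤ) : ℝ) = ((2 * n + 1 : ℤ) : ℝ) := by push_cast; linarith
  have h6 : 2 * l = 2 * n + 1 := by exact_mod_cast h5
  omega

lemma tendsto_winding_cobounded {k : ℕ} (c : Polygon ℂ k) :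
    Tendsto (winding c) (Bornology.cobounded ℂ) (𝓝 0) := by
  have h : ∀ a b : ℂ, Tendsto (fun x => Complex.arg ((b - x) / (a - x)))
      (Bornology.cobounded ℂ) (𝓝 0) := by
    intro a b
    have h1 : Tendsto (fun x : ℂ => a - x) (Bornology.cobounded ℂ) (Bornology.cobounded ℂ) :=
      tendsto_const_sub_cobounded a
    have h2 : Tendsto (fun x : ℂ => 1 + (b - a) * (a - x)⁻¹) (Bornology.cobounded ℂ) (𝓝 1) := by
      have := ((tendsto_inv₀_cobounded.comp h1).const_mul (b - a)).const_add 1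
      simpa using this
    have h3 : (fun x : ℂ => 1 + (b - a) * (a - x)⁻¹) =ᶠ[Bornology.cobounded ℂ]
        fun x => (b - x) / (a - x) := by
      have : ∀ᶠ x in Bornology.cobounded ℂ, x ≠ a := by
        have : ({a} : Set ℂ)ᶜ ∈ Bornology.cobounded ℂ :=
          Bornology.isBounded_def.1 Bornology.isBounded_singleton
        exact this
      filter_upwards [this] with x hx
      have : a - x ≠ 0 := sub_ne_zero.2 (Ne.symm hx)
      field_simp; ring
    have h4 := (Complex.continuousAt_arg Complex.one_mem_slitPlane).tendsto.comp
      (h2.congr' h3)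
    rw [Complex.arg_one] at h4
    exact h4
  have := tendsto_finsetSum Finset.univ fun m _ => h (c m) (c (finRotate k m))
  rw [Finset.sum_const_zero] at this
  exact this

/-- The winding tends to `0` at infinity, so an unbounded component contains a point where it is
smaller than `2π` in absolute value; there it vanishes by integrality. -/
lemma winding_eq_zero_of_not_isBounded {k : ℕ} {c : Polygon ℂ k} {x : ℂ}
    (hx : x ∉ c.boundary ℝ)
    (hb : ¬ Bornology.IsBounded (connectedComponentIn (c.boundary ℝ)ᶜ x)) :
    winding c x = 0 := by
  have hpi := Real.pi_pos
  have h1 : ∀ᶠ y in Bornology.cobounded ℂ, |winding c y| < 2 * Real.pi := by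
    have := (tendsto_winding_cobounded c).abs
    rw [abs_zero] at this
    exact this.eventually (gt_mem_nhds (by positivity))
  obtain ⟨y, hy, hy2⟩ : ∃ y ∈ connectedComponentIn (c.boundary ℝ)ᶜ x,
      |winding c y| < 2 * Real.pi := by
    by_contra hcon
    push Not at hcon
    apply hb
    rw [← Bornology.isCobounded_compl_iff]
    refine mem_of_superset h1 fun y hy hy' => ?_
    exact absurd hy (not_lt.2 (hcon y hy'))
  have hsub := connectedComponentIn_subset (c.boundary ℝ)ᶜ x
  rw [winding_eq_of_isPreconnected isPreconnected_connectedComponentIn hsub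
    (mem_connectedComponentIn hx) hy]
  obtain ⟨n, hn⟩ := exists_winding_eq_int (hsub hy)
  rw [hn] at hy2 ⊢
  rw [abs_mul, abs_of_pos (by positivity : 0 < 2 * Real.pi)] at hy2
  have h3 : |(n : ℝ)| < 1 := by
    by_contra h4
    push Not at h4
    nlinarith
  have : |n| < 1 := by exact_mod_cast h3
  rw [Int.abs_lt_one_iff] at this
  simp [this]

/-! ### Jump of the winding number across a side. -/

lemma tendsto_exp_mul_I {ε : ℝ} :
    Tendsto (fun φ : ℝ => Complex.exp ((ε * φ : ℝ) * Complex.I)) (𝓝[>] 0) (𝓝 1) := by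
  have : Continuous fun φ : ℝ => Complex.exp ((ε * φ : ℝ) * Complex.I) := by fun_prop
  have h := this.tendsto 0
  simp only [mul_zero, Complex.ofReal_zero, zero_mul, Complex.exp_zero] at h
  exact h.mono_left nhdsWithin_le_nhds

/-- The quotient tends to the negative number `1 - 1/s`, from above the real axis for `ε = 1` and
from below for `ε = -1`. The two limits are those of the argument on the two sides of its branch
cut. -/
lemma tendsto_arg_jump {a b : ℂ} (hab : a ≠ b) {s : ℝ} (hs0 : 0 < s) (hs1 : s < 1) {ε : ℝ}
    (hε : ε = 1 ∨ ε = -1) :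
    Tendsto (fun φ : ℝ => Complex.arg
      ((b - (a + s * Complex.exp ((ε * φ : ℝ) * Complex.I) * (b - a))) /
        (a - (a + s * Complex.exp ((ε * φ : ℝ) * Complex.I) * (b - a)))))
      (𝓝[>] 0) (𝓝 (ε * Real.pi)) := by
  have hba : b - a ≠ 0 := sub_ne_zero.2 hab.symm
  have hs : (s : ℂ) ≠ 0 := by exact_mod_cast hs0.ne'
  have e : ∀ φ : ℝ, (b - (a + s * Complex.exp ((ε * φ : ℝ) * Complex.I) * (b - a))) /
        (a - (a + s * Complex.exp ((ε * φ : ℝ) * Complex.I) * (b - a))) =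
        1 - ((1 / s : ℝ) : ℂ) * Complex.exp ((-ε * φ : ℝ) * Complex.I) := by
    intro φ
    have h1 : Complex.exp ((-ε * φ : ℝ) * Complex.I) * Complex.exp ((ε * φ : ℝ) * Complex.I) = 1 := by
      rw [← Complex.exp_add]; simp
    have h2 : Complex.exp ((ε * φ : ℝ) * Complex.I) ≠ 0 := Complex.exp_ne_zero _
    generalize Complex.exp ((ε * φ : ℝ) * Complex.I) = E at *
    generalize Complex.exp ((-ε * φ : ℝ) * Complex.I) = E' at *
    have h3 : E' = 1 / E := by field_simp; exact h1
    have h4 : a - (a + s * E * (b - a)) ≠ 0 := by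
      have : a - (a + s * E * (b - a)) = -(s * E * (b - a)) := by ring
      rw [this]
      exact neg_ne_zero.2 (mul_ne_zero (mul_ne_zero hs h2) hba)
    rw [div_eq_iff h4, h3]
    push_cast
    field_simp
    ring
  simp only [e]
  have hlim : Tendsto (fun φ : ℝ => 1 - ((1 / s : ℝ) : ℂ) * Complex.exp ((-ε * φ : ℝ) * Complex.I))
      (𝓝[>] 0) (𝓝 ((1 - 1 / s : ℝ) : ℂ)) := by
    have := (tendsto_exp_mul_I (ε := -ε)).const_mul ((1 / s : ℝ) : ℂ)
    have := this.const_sub 1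
    simpa using this
  have him : ∀ φ : ℝ, (1 - ((1 / s : ℝ) : ℂ) * Complex.exp ((-ε * φ : ℝ) * Complex.I)).im =
      1 / s * Real.sin (ε * φ) := by
    intro φ
    rw [Complex.sub_im, Complex.im_ofReal_mul, Complex.exp_ofReal_mul_I_im]
    simp
  have hs' : 1 < 1 / s := by rw [lt_div_iff₀ hs0]; linarith
  have hsmall : ∀ᶠ φ : ℝ in 𝓝[>] 0, 0 < φ ∧ φ < Real.pi := by
    filter_upwards [Ioo_mem_nhdsGT Real.pi_pos] with φ hφ using hφ
  rcases hε with rfl | rfl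
  · rw [one_mul]
    refine (Complex.tendsto_arg_nhdsWithin_im_nonneg_of_re_neg_of_im_zero (z := ((1 - 1 / s : ℝ) : ℂ))
      (by simpa using hs') (by simp)).comp (tendsto_nhdsWithin_iff.2 ⟨hlim, ?_⟩)
    filter_upwards [hsmall] with φ hφ
    have := Real.sin_pos_of_pos_of_lt_pi hφ.1 hφ.2
    change 0 ≤ Complex.im _
    rw [him, one_mul]
    positivity
  · rw [neg_one_mul]
    refine (Complex.tendsto_arg_nhdsWithin_im_neg_of_re_neg_of_im_zero (z := ((1 - 1 / s : ℝ) : ℂ))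
      (by simpa using hs') (by simp)).comp (tendsto_nhdsWithin_iff.2 ⟨hlim, ?_⟩)
    filter_upwards [hsmall] with φ hφ
    have := Real.sin_pos_of_pos_of_lt_pi hφ.1 hφ.2
    change Complex.im _ < 0
    rw [him, neg_one_mul, Real.sin_neg]
    have : 0 < 1 / s * Real.sin φ := by positivity
    linarith

lemma cross_exp_mul (z : ℂ) (φ : ℝ) :
    cross z (Complex.exp (φ * Complex.I) * z) = Real.sin φ * ‖z‖ ^ 2 := by
  rw [Complex.exp_mul_I]
  simp only [cross, Complex.mul_re, Complex.mul_im, Complex.add_re, Complex.add_im,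
    Complex.I_re, Complex.I_im, Complex.cos_ofReal_re, Complex.cos_ofReal_im,
    Complex.sin_ofReal_re, Complex.sin_ofReal_im, Complex.sq_norm, Complex.normSq_apply]
  ring

lemma cross_eq_zero_of_mem_segment {a b x : ℂ} (h : x ∈ segment ℝ a b) :
    cross (b - a) (x - a) = 0 := by
  rw [segment_eq_image'] at h
  obtain ⟨t, _, rfl⟩ := h
  simp [cross]; ring

/-- The winding number is different on the two sides of an edge of a simple polygon. -/
lemma eventually_winding_ne {k : ℕ} {c : Polygon ℂ k} (hc : IsSimplePolygon c) (m : Fin k)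
    {s : ℝ} (hs0 : 0 < s) (hs1 : s < 1) :
    ∀ᶠ φ : ℝ in 𝓝[>] 0,
      c m + s * Complex.exp ((1 * φ : ℝ) * Complex.I) * (c (finRotate k m) - c m) ∉ c.boundary ℝ ∧
      c m + s * Complex.exp ((-1 * φ : ℝ) * Complex.I) * (c (finRotate k m) - c m) ∉
        c.boundary ℝ ∧
      winding c (c m + s * Complex.exp ((1 * φ : ℝ) * Complex.I) * (c (finRotate k m) - c m)) ≠
      winding c (c m + s * Complex.exp ((-1 * φ : ℝ) * Complex.I) * (c (finRotate k m) - c m)) := by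
  obtain ⟨hk, hinj, hmeet⟩ := hc
  set a := c m with ha
  set b := c (finRotate k m) with hb
  have hab : a ≠ b := by
    intro h
    have h1 := hinj h
    obtain ⟨k', rfl⟩ : ∃ k', k = k' + 2 := ⟨k - 2, by omega⟩
    rw [finRotate_apply] at h1
    simp at h1
  have hba : b - a ≠ 0 := sub_ne_zero.2 hab.symm
  set y := a + s * (b - a) with hy
  have hyseg : y ∈ c.edgeSet ℝ m := by
    rw [edgeSet_eq_segment, segment_eq_image']
    exact ⟨s, ⟨hs0.le, hs1.le⟩, by simp [hy, ha, hb]⟩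
  have hya : y ≠ a := by
    intro h
    have : (s : ℂ) * (b - a) = 0 := by linear_combination h
    rcases mul_eq_zero.1 this with h | h
    · exact hs0.ne' (by exact_mod_cast h)
    · exact hba h
  have hyb : y ≠ b := by
    intro h
    have : ((1 - s : ℝ) : ℂ) * (b - a) = 0 := by push_cast; linear_combination -h
    rcases mul_eq_zero.1 this with h | h
    · have : 1 - s = 0 := by exact_mod_cast h
      linarith
    · exact hba h
  have hnot : ∀ j, j ≠ m → y ∉ segment ℝ (c j) (c (finRotate k j)) := by
    intro j hj hyj
    rw [← edgeSet_eq_segment] at hyj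
    have := (hmeet j m hj ⟨hyj, hyseg⟩).2
    rcases this with h | h
    · exact hya h
    · exact hyb h
  let X : ℝ → ℝ → ℂ := fun ε φ => a + s * Complex.exp ((ε * φ : ℝ) * Complex.I) * (b - a)
  have hX : ∀ ε, Tendsto (X ε) (𝓝[>] 0) (𝓝 y) := by
    intro ε
    have := ((tendsto_exp_mul_I (ε := ε)).const_mul (s : ℂ)).mul_const (b - a)
    simpa [X, hy] using this.const_add a
  -- The point `y` lies on side `m` only, so every other summand is continuous there. The limits
  -- from the two sides therefore differ by exactly `2π`.
  have hlim : ∀ ε : ℝ, ε = 1 ∨ ε = -1 → Tendsto (fun φ => winding c (X ε φ)) (𝓝[>] 0)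
      (𝓝 (ε * Real.pi + ∑ j ∈ Finset.univ.erase m,
        Complex.arg ((c (finRotate k j) - y) / (c j - y)))) := by
    intro ε hε
    have h1 : ∀ x, winding c x = Complex.arg ((b - x) / (a - x)) +
        ∑ j ∈ Finset.univ.erase m, Complex.arg ((c (finRotate k j) - x) / (c j - x)) := by
      intro x
      rw [winding, ← Finset.add_sum_erase _ _ (Finset.mem_univ m)]
    simp only [h1]
    refine (tendsto_arg_jump hab hs0 hs1 hε).add (tendsto_finsetSum _ fun j hj => ?_)
    exact (continuousAt_arg_div (hnot j (Finset.ne_of_mem_erase hj))).tendsto.comp (hX ε)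
  have hdiff := (hlim 1 (Or.inl rfl)).sub (hlim (-1) (Or.inr rfl))
  have hne : ∀ᶠ φ in 𝓝[>] 0, winding c (X 1 φ) - winding c (X (-1) φ) ≠ 0 := by
    refine hdiff.eventually_ne ?_
    have := Real.pi_pos
    intro h
    linarith
  have hoff : ∀ ε : ℝ, ε = 1 ∨ ε = -1 → ∀ᶠ φ in 𝓝[>] 0, X ε φ ∉ c.boundary ℝ := by
    intro ε hε
    have h1 : ∀ᶠ φ in 𝓝[>] 0, ∀ j, j ≠ m → X ε φ ∉ segment ℝ (c j) (c (finRotate k j)) := by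
      rw [eventually_all]
      intro j
      by_cases hj : j = m
      · simp [hj]
      · filter_upwards [(hX ε).eventually ((isClosed_segment _ _).isOpen_compl.mem_nhds
          (hnot j hj))] with φ hφ _ using hφ
    filter_upwards [h1, Ioo_mem_nhdsGT Real.pi_pos] with φ h2 hφ h3
    obtain ⟨j, hj⟩ := mem_iUnion.1 h3
    rw [edgeSet_eq_segment] at hj
    by_cases hjm : j = m
    · subst hjm
      have h4 := cross_eq_zero_of_mem_segment hj
      have h5 : X ε φ - c j = s * (Complex.exp ((ε * φ : ℝ) * Complex.I) * (b - a)) := by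
        simp only [X, ha]; ring
      rw [h5, cross_mul, ← hb, ← ha, cross_exp_mul] at h4
      have h6 : Real.sin (ε * φ) ≠ 0 := by
        have := (Real.sin_pos_of_pos_of_lt_pi hφ.1 hφ.2).ne'
        rcases hε with rfl | rfl <;> simpa using this
      have h7 : ‖b - a‖ ^ 2 ≠ 0 := by simpa using hba
      exact mul_ne_zero hs0.ne' (mul_ne_zero h6 h7) h4
    · exact h2 j hjm hj
  filter_upwards [hne, hoff 1 (Or.inl rfl), hoff (-1) (Or.inr rfl)] with φ h1 h2 h3
  exact ⟨h2, h3, sub_ne_zero.1 h1⟩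

end PlaneFramework

namespace PlaneFramework

/-! ### Sectors around a vertex -/

variable {V : Type*} {G : SimpleGraph V} {p : V → ℂ}

lemma InGeneralPosition.sub_ne_zero (hp : InGeneralPosition p) {v i : V} (h : i ≠ v) :
    p i - p v ≠ 0 := _root_.sub_ne_zero.2 fun e => h (hp.1 e)

lemma InGeneralPosition.cross_ne_zero (hp : InGeneralPosition p) {v i j : V} (hi : i ≠ v)
    (hj : j ≠ v) (hij : i ≠ j) : cross (p i - p v) (p j - p v) ≠ 0 := by
  rw [Ne, ← collinear_iff_cross]
  exact hp.2 v i j hi.symm hij hj.symm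

lemma InGeneralPosition.eq_of_sub_eq_mul (hp : InGeneralPosition p) {v i j : V} (hi : i ≠ v)
    (hj : j ≠ v) {r : ℝ} (h : p j - p v = r * (p i - p v)) : i = j := by
  by_contra hij
  apply hp.cross_ne_zero hi hj hij
  rw [h, cross_mul, cross_self, mul_zero]

/-- The direction `z` lies strictly inside the sector at `v` which starts at the edge `vi` and
extends counterclockwise up to the next edge. -/
def InSector (G : SimpleGraph V) (p : V → ℂ) (v i : V) (z : ℂ) : Prop :=
  z ≠ 0 ∧ ∀ k, G.Adj v k → ccwAngle (p i - p v) z < ccwAngle (p i - p v) (p k - p v)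

/-- If `z` lay in both sectors, the angles from `z` to the two edges would satisfy two incompatible
relations: adding up the four angles between `z` and the edges gives `2π` by subtraction inside the
sectors, but `4π` from the two full turns. -/
lemma InSector.unique (hp : InGeneralPosition p) {v i j : V} {z : ℂ} (hi : G.Adj v i)
    (hj : G.Adj v j) (h1 : InSector G p v i z) (h2 : InSector G p v j z) : i = j := by
  have hz := h1.1
  have ha := hp.sub_ne_zero hi.ne'
  have hb := hp.sub_ne_zero hj.ne'
  by_contra hij
  have hlt : ccwAngle (p i - p v) (p j - p v) < 2 * Real.pi := by
    refine lt_of_le_of_ne (ccwAngle_le _ _) fun h => ?_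
    rw [← ccwAngle_self ha] at h
    obtain ⟨r, _, hr⟩ := eq_mul_of_ccwAngle_eq ha hb ha h
    exact hij (hp.eq_of_sub_eq_mul hj.ne' hi.ne' hr).symm
  have e1 := ccwAngle_sub ha hz hb (h1.2 j hj)
  have e2 := ccwAngle_sub hb hz ha (h2.2 i hi)
  have e3 := ccwAngle_swap ha hb hlt
  have e4 := ccwAngle_swap ha hz ((h1.2 j hj).trans_le (ccwAngle_le _ _))
  have e5 := ccwAngle_swap hb hz ((h2.2 i hi).trans_le (ccwAngle_le _ _))
  have := Real.pi_pos
  linarith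

/-- The sector starts at the last edge met before `z` in the counterclockwise order, that is, the
one with the smallest angle to `z`. -/
lemma exists_inSector [Finite V] (hp : InGeneralPosition p) {v : V} (hv : ∃ k, G.Adj v k)
    {z : ℂ} (hz : z ≠ 0) (hne : ∀ k, G.Adj v k → ∀ r : ℝ, 0 < r → z ≠ r * (p k - p v)) :
    ∃ i, G.Adj v i ∧ InSector G p v i z := by
  obtain ⟨i, hi, hmin⟩ := Set.exists_min_image {k | G.Adj v k}
    (fun i => ccwAngle (p i - p v) z) (Set.toFinite _) hv
  refine ⟨i, hi, hz, fun k hk => ?_⟩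
  have ha := hp.sub_ne_zero (G.ne_of_adj hi).symm
  have hb := hp.sub_ne_zero hk.ne'
  by_contra hlt
  rcases (not_lt.1 hlt).lt_or_eq with h | h
  · have h1 := ccwAngle_sub ha hb hz h
    have h2 := hmin k hk
    have h3 := ccwAngle_pos (p i - p v) (p k - p v)
    linarith
  · obtain ⟨r, hr, e⟩ := eq_mul_of_ccwAngle_eq ha hb hz h
    exact hne k hk r hr e

lemma exists_areConsecutive [Finite V] {v i : V} (hi : G.Adj v i) :
    ∃ j, AreConsecutive G p v i j := by
  obtain ⟨j, hj, hmin⟩ := Set.exists_min_image {k | G.Adj v k}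
    (fun j => ccwAngle (p i - p v) (p j - p v)) (Set.toFinite _) ⟨i, hi⟩
  exact ⟨j, hi, hj, hmin⟩

lemma AreConsecutive.unique (hp : InGeneralPosition p) {v i j k : V}
    (h1 : AreConsecutive G p v i j) (h2 : AreConsecutive G p v i k) : j = k := by
  have e := le_antisymm (h1.2.2 k h2.2.1) (h2.2.2 j h1.2.1)
  obtain ⟨r, _, hr⟩ := eq_mul_of_ccwAngle_eq (hp.sub_ne_zero h1.1.ne')
    (hp.sub_ne_zero h1.2.1.ne') (hp.sub_ne_zero h2.2.1.ne') e
  exact hp.eq_of_sub_eq_mul h1.2.1.ne' h2.2.1.ne' hr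

lemma AreConsecutive.inSector_iff {v i j : V} (h : AreConsecutive G p v i j) {z : ℂ} :
    InSector G p v i z ↔
      z ≠ 0 ∧ ccwAngle (p i - p v) z < ccwAngle (p i - p v) (p j - p v) :=
  and_congr_right fun _ => ⟨fun h' => h' j h.2.1, fun h' k hk => h'.trans_le (h.2.2 k hk)⟩

lemma AreConsecutive.ccwAngle_ne_pi (hp : InGeneralPosition p) {v i j : V}
    (h : AreConsecutive G p v i j) : ccwAngle (p i - p v) (p j - p v) ≠ Real.pi := by
  intro e
  have ha := hp.sub_ne_zero h.1.ne'
  have hb := hp.sub_ne_zero h.2.1.ne'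
  by_cases hij : i = j
  · subst hij
    rw [ccwAngle_self ha] at e
    have := Real.pi_pos
    linarith
  · apply hp.cross_ne_zero h.1.ne' h.2.1.ne' hij
    rw [cross_eq_sin _ ha hb, e, Real.sin_pi, mul_zero]

/-- A sector with an angle larger than `π` contains every direction or its opposite. -/
lemma InSector.or_neg (hp : InGeneralPosition p) {v i j : V} (h : AreConsecutive G p v i j)
    (hpi : Real.pi < ccwAngle (p i - p v) (p j - p v)) {z : ℂ}
    (hz : cross (p i - p v) z ≠ 0) : InSector G p v i z ∨ InSector G p v i (-z) := by
  have ha := hp.sub_ne_zero h.1.ne'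
  have hz0 : z ≠ 0 := by rintro rfl; exact hz (cross_zero _)
  rw [h.inSector_iff, h.inSector_iff]
  rcases ccwAngle_neg ha hz0 with ⟨h1, -⟩ | ⟨h1, h2⟩
  · left; exact ⟨hz0, by linarith⟩
  · right
    refine ⟨neg_ne_zero.2 hz0, ?_⟩
    have := ccwAngle_le (p i - p v) z
    linarith

/-! ### The drawing near a vertex -/

/-- Within distance `r` of a vertex, only the edges incident to this vertex are drawn. -/
def IsLocalRadius (G : SimpleGraph V) (p : V → ℂ) (r : ℝ) : Prop :=
  0 < r ∧ ∀ v x, x ≠ p v → ‖x - p v‖ < r →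
    (x ∈ drawing G p ↔ ∃ k, G.Adj v k ∧ ∃ t : ℝ, 0 < t ∧ x - p v = t * (p k - p v))

lemma mem_segment_iff_sub {a b x : ℂ} :
    x ∈ segment ℝ a b ↔ ∃ t : ℝ, 0 ≤ t ∧ t ≤ 1 ∧ x - a = t * (b - a) := by
  rw [segment_eq_image']
  constructor
  · rintro ⟨t, ht, rfl⟩
    exact ⟨t, ht.1, ht.2, by simp⟩
  · rintro ⟨t, h0, h1, e⟩
    exact ⟨t, ⟨h0, h1⟩, by simp only [Complex.real_smul]; linear_combination -e⟩

/-- By general position a vertex has positive distance from the other vertices and from every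
segment between two other vertices, and there are finitely many of these. -/
lemma exists_isLocalRadius [Finite V] (hp : InGeneralPosition p) :
    ∃ r, IsLocalRadius G p r := by
  have h1 : ∀ᶠ r : ℝ in 𝓝[>] 0, ∀ v k, k ≠ v → r < ‖p k - p v‖ := by
    refine eventually_all.2 fun v => eventually_all.2 fun k => ?_
    by_cases h : k = v
    · simp [h]
    · have : 0 < ‖p k - p v‖ := norm_pos_iff.2 (hp.sub_ne_zero h)
      filter_upwards [Ioo_mem_nhdsGT this] with r hr _ using hr.2
  have h2 : ∀ᶠ r : ℝ in 𝓝[>] 0, ∀ v a b, v ≠ a → v ≠ b → a ≠ b → ∀ x ∈ segment ℝ (p a) (p b),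
      r < ‖x - p v‖ := by
    refine eventually_all.2 fun v => eventually_all.2 fun a => eventually_all.2 fun b => ?_
    by_cases ha : v = a
    · simp [ha]
    by_cases hb : v = b
    · simp [hb]
    by_cases hab : a = b
    · simp [hab]
    have hnot : p v ∉ segment ℝ (p a) (p b) := by
      intro h
      obtain ⟨t, _, _, e⟩ := mem_segment_iff_sub.1 h
      exact hb (hp.eq_of_sub_eq_mul (Ne.symm hab) ha e).symm
    obtain ⟨ε, hε, hball⟩ := Metric.isOpen_iff.1 (isClosed_segment (p a) (p b)).isOpen_compl _ hnot
    filter_upwards [Ioo_mem_nhdsGT hε] with r hr _ _ _ x hx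
    by_contra hle
    refine hball (?_ : x ∈ Metric.ball (p v) ε) hx
    rw [Metric.mem_ball, dist_eq_norm]
    exact (not_lt.1 hle).trans_lt hr.2
  obtain ⟨r, ⟨h3, h4⟩, h0⟩ := ((h1.and h2).and self_mem_nhdsWithin).exists
  refine ⟨r, h0, fun v x hx hxr => ⟨?_, ?_⟩⟩
  · rintro (⟨k, rfl⟩ | ⟨a, b, hab, hxab⟩)
    · by_cases hk : k = v
      · exact absurd (by rw [hk]) hx
      · exact absurd (h3 v k hk) (not_lt.2 hxr.le)
    · by_cases ha : v = a
      · subst ha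
        obtain ⟨t, ht0, _, e⟩ := mem_segment_iff_sub.1 hxab
        refine ⟨b, hab, t, lt_of_le_of_ne ht0 ?_, e⟩
        rintro rfl
        exact hx (sub_eq_zero.1 (by simpa using e))
      · by_cases hb : v = b
        · subst hb
          rw [segment_symm] at hxab
          obtain ⟨t, ht0, _, e⟩ := mem_segment_iff_sub.1 hxab
          refine ⟨a, hab.symm, t, lt_of_le_of_ne ht0 ?_, e⟩
          rintro rfl
          exact hx (sub_eq_zero.1 (by simpa using e))
        · exact absurd (h4 v a b ha hb hab.ne x hxab) (not_lt.2 hxr.le)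
  · rintro ⟨k, hk, t, ht, e⟩
    refine Or.inr ⟨v, k, hk, mem_segment_iff_sub.2 ⟨t, ht.le, ?_, e⟩⟩
    have h5 := h3 v k hk.ne'
    rw [e, norm_mul, Complex.norm_real, Real.norm_of_nonneg ht.le] at hxr
    by_contra h6
    push Not at h6
    nlinarith

/-- The points of a small disc around `v` which lie in the sector starting at the edge `vi`. -/
def sectorRegion (G : SimpleGraph V) (p : V → ℂ) (r : ℝ) (v i : V) : Set ℂ :=
  {x | ‖x - p v‖ < r ∧ InSector G p v i (x - p v)}

variable {r : ℝ}

lemma sectorRegion_subset (hr : IsLocalRadius G p r) (v i : V) :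
    sectorRegion G p r v i ⊆ (drawing G p)ᶜ := by
  rintro x ⟨hx, hs⟩ hd
  obtain ⟨k, hk, t, ht, e⟩ := (hr.2 v x (sub_ne_zero.1 hs.1) hx).1 hd
  have := hs.2 k hk
  rw [e, ccwAngle_mul_left ht] at this
  exact lt_irrefl _ this

lemma exists_mem_sectorRegion [Finite V] (hp : InGeneralPosition p) (hr : IsLocalRadius G p r)
    {v : V} (hv : ∃ k, G.Adj v k) {x : ℂ} (hx : x ∉ drawing G p) (hxr : ‖x - p v‖ < r) :
    ∃ i, G.Adj v i ∧ x ∈ sectorRegion G p r v i := by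
  have hne : x ≠ p v := by
    rintro rfl
    exact hx (Or.inl ⟨v, rfl⟩)
  obtain ⟨i, hi, hs⟩ := exists_inSector (G := G) hp hv (sub_ne_zero.2 hne) fun k hk t ht e =>
    hx ((hr.2 v x hne hxr).2 ⟨k, hk, t, ht, e⟩)
  exact ⟨i, hi, hxr, hs⟩

lemma norm_mul_exp (t φ : ℝ) (ht : 0 < t) (a : ℂ) :
    ‖(t : ℂ) * Complex.exp (φ * Complex.I) * a‖ = t * ‖a‖ := by
  rw [norm_mul, norm_mul, Complex.norm_exp_ofReal_mul_I, Complex.norm_real,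
    Real.norm_of_nonneg ht.le, mul_one]

lemma AreConsecutive.mem_sectorRegion (hp : InGeneralPosition p) {v i j : V}
    (h : AreConsecutive G p v i j) {t φ : ℝ} (ht : 0 < t) (htr : t * ‖p i - p v‖ < r)
    (hφ : 0 < φ) (hφ' : φ < ccwAngle (p i - p v) (p j - p v)) :
    p v + t * Complex.exp (φ * Complex.I) * (p i - p v) ∈ sectorRegion G p r v i := by
  have ha := hp.sub_ne_zero h.1.ne'
  constructor
  · rwa [add_sub_cancel_left, norm_mul_exp _ _ ht]
  · rw [h.inSector_iff, add_sub_cancel_left]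
    refine ⟨?_, ?_⟩
    · rw [← norm_pos_iff, norm_mul_exp _ _ ht]
      have := norm_pos_iff.2 ha
      positivity
    · rwa [ccwAngle_eq ha ht hφ (hφ'.le.trans (ccwAngle_le _ _))]

/-- Polar coordinates show the region as a continuous image of a rectangle. This is what makes it
connected, hence contained in a single face. -/
lemma AreConsecutive.sectorRegion_eq_image (hp : InGeneralPosition p) {v i j : V}
    (h : AreConsecutive G p v i j) :
    sectorRegion G p r v i =
      (fun q : ℝ × ℝ => p v + q.1 * Complex.exp (q.2 * Complex.I) * (p i - p v)) ''
        (Ioo 0 (r / ‖p i - p v‖) ×ˢ Ioo 0 (ccwAngle (p i - p v) (p j - p v))) := by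
  have ha := hp.sub_ne_zero h.1.ne'
  have ha' := norm_pos_iff.2 ha
  ext x
  constructor
  · rintro ⟨hx, hs⟩
    rw [h.inSector_iff] at hs
    have hz := norm_pos_iff.2 hs.1
    refine ⟨(‖x - p v‖ / ‖p i - p v‖, ccwAngle (p i - p v) (x - p v)),
      ⟨⟨by positivity, ?_⟩, ccwAngle_pos _ _, hs.2⟩, ?_⟩
    · exact div_lt_div_of_pos_right hx ha'
    · simp only
      rw [← ccwAngle_spec ha hs.1]; ring
  · rintro ⟨⟨t, φ⟩, ⟨⟨ht, htr⟩, hφ, hφ'⟩, rfl⟩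
    exact h.mem_sectorRegion hp ht ((lt_div_iff₀ ha').1 htr) hφ hφ'

lemma isPreconnected_sectorRegion [Finite V] (hp : InGeneralPosition p) {v i : V}
    (hi : G.Adj v i) : IsPreconnected (sectorRegion G p r v i) := by
  obtain ⟨j, h⟩ := exists_areConsecutive (p := p) hi
  rw [h.sectorRegion_eq_image hp]
  exact (isPreconnected_Ioo.prod isPreconnected_Ioo).image _ (by fun_prop)

lemma sectorRegion_nonempty [Finite V] (hp : InGeneralPosition p) (hr : 0 < r) {v i : V}
    (hi : G.Adj v i) : (sectorRegion G p r v i).Nonempty := by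
  obtain ⟨j, h⟩ := exists_areConsecutive (p := p) hi
  rw [h.sectorRegion_eq_image hp]
  have ha' := norm_pos_iff.2 (hp.sub_ne_zero hi.ne')
  exact ((nonempty_Ioo.2 (div_pos hr ha')).prod (nonempty_Ioo.2 (ccwAngle_pos _ _))).image _

lemma AreConsecutive.mem_closure_sectorRegion (hp : InGeneralPosition p) {v i j : V}
    (h : AreConsecutive G p v i j) {t φ : ℝ} (ht : 0 < t) (htr : t * ‖p i - p v‖ < r)
    (hφ : 0 ≤ φ) (hφ' : φ ≤ ccwAngle (p i - p v) (p j - p v)) :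
    p v + t * Complex.exp (φ * Complex.I) * (p i - p v) ∈ closure (sectorRegion G p r v i) := by
  have hc : Continuous fun φ : ℝ => p v + t * Complex.exp (φ * Complex.I) * (p i - p v) := by
    fun_prop
  have h1 := image_closure_subset_closure_image (s := Ioo 0 (ccwAngle (p i - p v) (p j - p v))) hc
  rw [closure_Ioo (ccwAngle_pos _ _).ne] at h1
  refine closure_mono ?_ (h1 ⟨φ, ⟨hφ, hφ'⟩, rfl⟩)
  rintro _ ⟨ψ, hψ, rfl⟩
  exact h.mem_sectorRegion hp ht htr hψ.1 hψ.2

lemma AreConsecutive.mem_closure_fst (hp : InGeneralPosition p) {v i j : V}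
    (h : AreConsecutive G p v i j) {t : ℝ} (ht : 0 < t) (htr : t * ‖p i - p v‖ < r) :
    p v + t * (p i - p v) ∈ closure (sectorRegion G p r v i) := by
  simpa using h.mem_closure_sectorRegion hp ht htr le_rfl (ccwAngle_pos _ _).le

lemma AreConsecutive.mem_closure_snd (hp : InGeneralPosition p) {v i j : V}
    (h : AreConsecutive G p v i j) {t : ℝ} (ht : 0 < t) (htr : t * ‖p j - p v‖ < r) :
    p v + t * (p j - p v) ∈ closure (sectorRegion G p r v i) := by
  have ha := hp.sub_ne_zero h.1.ne'
  have hb := hp.sub_ne_zero h.2.1.ne'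
  have ha' := norm_pos_iff.2 ha
  have hb' := norm_pos_iff.2 hb
  have h1 := h.mem_closure_sectorRegion hp (r := r) (t := t * (‖p j - p v‖ / ‖p i - p v‖))
    (by positivity) (by rw [mul_assoc, div_mul_cancel₀ _ ha'.ne']; exact htr)
    (ccwAngle_pos _ _).le le_rfl
  have h2 := ccwAngle_spec ha hb
  convert h1 using 2
  conv_lhs => rw [h2]
  push_cast
  ring

/-! ### Faces -/

lemma IsFace.subset {F : Set ℂ} (hF : IsFace G p F) : F ⊆ (drawing G p)ᶜ := by
  obtain ⟨x, _, rfl⟩ := hF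
  exact connectedComponentIn_subset _ _

lemma IsFace.isPreconnected {F : Set ℂ} (hF : IsFace G p F) : IsPreconnected F := by
  obtain ⟨x, _, rfl⟩ := hF
  exact isPreconnected_connectedComponentIn

lemma IsFace.nonempty {F : Set ℂ} (hF : IsFace G p F) : F.Nonempty := by
  obtain ⟨x, hx, rfl⟩ := hF
  exact ⟨x, mem_connectedComponentIn hx⟩

lemma IsFace.subset_of_mem {F S : Set ℂ} (hF : IsFace G p F) (hS : IsPreconnected S)
    (hd : S ⊆ (drawing G p)ᶜ) {x : ℂ} (hx : x ∈ S) (hxF : x ∈ F) : S ⊆ F := by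
  obtain ⟨y, _, rfl⟩ := hF
  rw [connectedComponentIn_eq hxF]
  exact hS.subset_connectedComponentIn hx hd

lemma IsFace.eq_of_mem {F F' : Set ℂ} (hF : IsFace G p F) (hF' : IsFace G p F') {x : ℂ}
    (hx : x ∈ F) (hx' : x ∈ F') : F = F' :=
  (hF'.subset_of_mem hF.isPreconnected hF.subset hx hx').antisymm
    (hF.subset_of_mem hF'.isPreconnected hF'.subset hx' hx)

lemma exists_isFace {x : ℂ} (hx : x ∉ drawing G p) : ∃ F, IsFace G p F ∧ x ∈ F :=
  ⟨_, ⟨x, hx, rfl⟩, mem_connectedComponentIn hx⟩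

end PlaneFramework

namespace PlaneFramework

/-! ### Bounded faces and their polygons -/

lemma ccwAngle_lt_of_cross {a z b : ℂ} (ha : a ≠ 0) (hz : z ≠ 0) (hb : b ≠ 0)
    (h1 : 0 < cross a z) (h2 : 0 < cross z b) : ccwAngle a z < ccwAngle a b := by
  rw [cross_pos_iff ha hz] at h1
  by_contra hlt
  rcases (not_lt.1 hlt).lt_or_eq with h | h
  · have h3 := ccwAngle_sub ha hb hz h
    have h4 : 0 < cross b z := by
      rw [cross_pos_iff hb hz, h3]
      have := ccwAngle_pos a b
      linarith
    rw [cross_comm] at h4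
    linarith
  · obtain ⟨t, _, rfl⟩ := eq_mul_of_ccwAngle_eq ha hb hz h
    rw [mul_cross, cross_self] at h2
    simp at h2

lemma finRotate_ne_symm {k : ℕ} (hk : 3 ≤ k) (m : Fin k) :
    finRotate k m ≠ (finRotate k).symm m := by
  intro h
  rw [Equiv.eq_symm_apply] at h
  obtain ⟨k, rfl⟩ : ∃ k', k = k' + 3 := ⟨k - 3, by omega⟩
  rw [finRotate_apply, finRotate_apply, add_assoc, add_eq_left] at h
  have := congrArg Fin.val h
  rw [Fin.val_add, Fin.val_one, Nat.mod_eq_of_lt (by omega)] at this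
  simp at this

variable {V : Type*} {G : SimpleGraph V} {p : V → ℂ} {r : ℝ}

/-- The face `F` is the interior of the simple polygon with the vertices `w m`. -/
structure IsFacePolygon (G : SimpleGraph V) (p : V → ℂ) (F : Set ℂ) {k : ℕ} (w : Fin k → V) :
    Prop where
  face : IsFace G p F
  adj : ∀ m, G.Adj (w m) (w (finRotate k m))
  simple : IsSimplePolygon (Polygon.mk (p ∘ w))
  eq : F = polygonInterior (Polygon.mk (p ∘ w))

namespace IsFacePolygon

variable {F : Set ℂ} {k : ℕ} {w : Fin k → V}

lemma injective (h : IsFacePolygon G p F w) : Function.Injective w :=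
  Function.Injective.of_comp (f := p) h.simple.2.1

lemma adj_symm (h : IsFacePolygon G p F w) (m : Fin k) :
    G.Adj (w m) (w ((finRotate k).symm m)) := by
  have := h.adj ((finRotate k).symm m)
  rw [Equiv.apply_symm_apply] at this
  exact this.symm

lemma next_ne_prev (h : IsFacePolygon G p F w) (m : Fin k) :
    w (finRotate k m) ≠ w ((finRotate k).symm m) :=
  fun e => finRotate_ne_symm h.simple.1 m (h.injective e)

lemma mem_boundary_iff {x : ℂ} : x ∈ (Polygon.mk (p ∘ w)).boundary ℝ ↔
    ∃ m, x ∈ segment ℝ (p (w m)) (p (w (finRotate k m))) := by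
  simp only [Polygon.boundary, mem_iUnion, edgeSet_eq_segment]
  rfl

lemma boundary_subset (h : IsFacePolygon G p F w) :
    (Polygon.mk (p ∘ w)).boundary ℝ ⊆ drawing G p := by
  intro x hx
  obtain ⟨m, hm⟩ := mem_boundary_iff.1 hx
  exact Or.inr ⟨_, _, h.adj m, hm⟩

/-- Off the polygon, `y` would have an open component of the complement around it. This component
meets `F`, so it is bounded and `y` belongs to the interior `F`, which is disjoint from the drawing.
-/
lemma mem_boundary_of_mem_closure (h : IsFacePolygon G p F w) {y : ℂ} (hy : y ∈ closure F)
    (hyd : y ∈ drawing G p) : y ∈ (Polygon.mk (p ∘ w)).boundary ℝ := by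
  by_contra hn
  set c := Polygon.mk (p ∘ w)
  have ho : IsOpen (connectedComponentIn (c.boundary ℝ)ᶜ y) :=
    (isClosed_boundary c).isOpen_compl.connectedComponentIn
  obtain ⟨x, hx, hxF⟩ := mem_closure_iff.1 hy _ ho (mem_connectedComponentIn hn)
  have hxF' := hxF
  rw [h.eq] at hxF'
  have hyF : y ∈ F := by
    rw [h.eq]
    refine ⟨hn, ?_⟩
    rw [connectedComponentIn_eq hx]
    exact hxF'.2
  exact h.face.subset hyF hyd

lemma mem_of_winding_ne_zero (h : IsFacePolygon G p F w) {x : ℂ}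
    (hx : x ∉ (Polygon.mk (p ∘ w)).boundary ℝ) (hw : winding (Polygon.mk (p ∘ w)) x ≠ 0) :
    x ∈ F := by
  rw [h.eq]
  refine ⟨hx, ?_⟩
  by_contra hb
  exact hw (winding_eq_zero_of_not_isBounded hx hb)

lemma winding_eq_zero (h : IsFacePolygon G p F w) {x : ℂ} (hx : x ∉ drawing G p) (hxF : x ∉ F) :
    winding (Polygon.mk (p ∘ w)) x = 0 := by
  by_contra hw
  exact hxF (h.mem_of_winding_ne_zero (fun hx' => hx (h.boundary_subset hx')) hw)

lemma winding_eq (h : IsFacePolygon G p F w) {x y : ℂ} (hx : x ∈ F) (hy : y ∈ F) :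
    winding (Polygon.mk (p ∘ w)) x = winding (Polygon.mk (p ∘ w)) y :=
  winding_eq_of_isPreconnected h.face.isPreconnected
    (fun _ hz hz' => h.face.subset hz (h.boundary_subset hz')) hx hy

/-- Points on the two sides of an edge of the polygon of a face: one of them is in the face,
and they are not both in the face. -/
lemma eventually_side (h : IsFacePolygon G p F w) (m : Fin k) {s : ℝ} (hs0 : 0 < s)
    (hs1 : s < 1) : ∀ᶠ φ : ℝ in 𝓝[>] 0,
      (p (w m) + s * Complex.exp ((1 * φ : ℝ) * Complex.I) * (p (w (finRotate k m)) - p (w m)) ∈ F ∨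
      p (w m) + s * Complex.exp ((-1 * φ : ℝ) * Complex.I) * (p (w (finRotate k m)) - p (w m)) ∈ F) ∧
      ¬ (p (w m) + s * Complex.exp ((1 * φ : ℝ) * Complex.I) * (p (w (finRotate k m)) - p (w m)) ∈ F ∧
      p (w m) + s * Complex.exp ((-1 * φ : ℝ) * Complex.I) * (p (w (finRotate k m)) - p (w m)) ∈ F) := by
  filter_upwards [eventually_winding_ne h.simple m hs0 hs1] with φ ⟨h1, h2, h3⟩
  refine ⟨?_, fun ⟨h4, h5⟩ => h3 (h.winding_eq h4 h5)⟩
  by_contra hn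
  push Not at hn
  apply h3
  have e1 : winding (Polygon.mk (p ∘ w)) _ = 0 :=
    not_not.1 fun hw => hn.1 (h.mem_of_winding_ne_zero h1 hw)
  have e2 : winding (Polygon.mk (p ∘ w)) _ = 0 :=
    not_not.1 fun hw => hn.2 (h.mem_of_winding_ne_zero h2 hw)
  exact e1.trans e2.symm

/-- A zero winding on `F` would make the winding vanish everywhere off the polygon, against its jump
across a side. -/
lemma winding_ne_zero (h : IsFacePolygon G p F w) {x : ℂ} (hx : x ∈ F) :
    winding (Polygon.mk (p ∘ w)) x ≠ 0 := by
  have m : Fin k := ⟨0, by have := h.simple.1; omega⟩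
  obtain ⟨φ, h1, h2, h3⟩ := (eventually_winding_ne h.simple m one_half_pos one_half_lt_one).exists
  intro h0
  apply h3
  have key : ∀ y, y ∉ (Polygon.mk (p ∘ w)).boundary ℝ → winding (Polygon.mk (p ∘ w)) y = 0 := by
    intro y hy
    by_contra hw
    exact hw ((h.winding_eq (h.mem_of_winding_ne_zero hy hw) hx).trans h0)
  exact (key _ h1).trans (key _ h2).symm

end IsFacePolygon

/-- `IsNonCrossing` speaks only of edges without common endpoint. Edges that share one cannot
overlap because no three points are collinear. -/
lemma edge_eq_of_mem_segment (hp : InGeneralPosition p) (hN : IsNonCrossing G p) {v i a b : V}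
    (hvi : G.Adj v i) (hab : G.Adj a b) {t : ℝ} (h0 : 0 < t) (h1 : t < 1)
    (hm : p v + t * (p i - p v) ∈ segment ℝ (p a) (p b)) : (a = v ∧ b = i) ∨ (a = i ∧ b = v) := by
  have hseg : p v + t * (p i - p v) ∈ segment ℝ (p v) (p i) :=
    mem_segment_iff_sub.2 ⟨t, h0.le, h1.le, by ring⟩
  have htC : (t : ℂ) ≠ 0 := by exact_mod_cast h0.ne'
  have key1 : ∀ b, G.Adj v b → p v + t * (p i - p v) ∈ segment ℝ (p v) (p b) → b = i := by
    intro b hb hm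
    obtain ⟨s, hs0, hs1, e⟩ := mem_segment_iff_sub.1 hm
    refine hp.eq_of_sub_eq_mul hb.ne' hvi.ne' (r := s / t) ?_
    push_cast
    field_simp
    linear_combination e
  have key2 : ∀ b, G.Adj i b → p v + t * (p i - p v) ∈ segment ℝ (p i) (p b) → b = v := by
    intro b hb hm
    obtain ⟨s, hs0, hs1, e⟩ := mem_segment_iff_sub.1 hm
    have h1C : ((1 - t : ℝ) : ℂ) ≠ 0 := by
      have : 1 - t ≠ 0 := by linarith
      exact_mod_cast this
    refine hp.eq_of_sub_eq_mul hb.ne' hvi.ne (r := s / (1 - t)) ?_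
    push_cast at h1C ⊢
    field_simp
    linear_combination e
  by_cases e1 : v = a
  · subst e1; exact Or.inl ⟨rfl, key1 b hab hm⟩
  by_cases e2 : v = b
  · subst e2
    rw [segment_symm] at hm
    exact Or.inr ⟨key1 a hab.symm hm, rfl⟩
  by_cases e3 : i = a
  · subst e3; exact Or.inr ⟨rfl, key2 b hab hm⟩
  by_cases e4 : i = b
  · subst e4
    rw [segment_symm] at hm
    exact Or.inl ⟨key2 a hab.symm hm, rfl⟩
  exact absurd hm (Set.disjoint_left.1 (hN v i a b hvi hab e1 e2 e3 e4) hseg)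

/-- The same region, described by turning clockwise from its final edge instead of counterclockwise
from its initial one. -/
lemma AreConsecutive.mem_sectorRegion_snd (hp : InGeneralPosition p) {v i j : V}
    (h : AreConsecutive G p v i j) {t φ : ℝ} (ht : 0 < t) (htr : t * ‖p j - p v‖ < r)
    (hφ : 0 < φ) (hφ' : φ < ccwAngle (p i - p v) (p j - p v)) :
    p v + t * Complex.exp ((-1 * φ : ℝ) * Complex.I) * (p j - p v) ∈ sectorRegion G p r v i := by
  have ha := norm_pos_iff.2 (hp.sub_ne_zero h.1.ne')
  have hb := norm_pos_iff.2 (hp.sub_ne_zero h.2.1.ne')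
  have e := ccwAngle_spec (hp.sub_ne_zero h.1.ne') (hp.sub_ne_zero h.2.1.ne')
  have key := h.mem_sectorRegion hp (r := r) (t := t * (‖p j - p v‖ / ‖p i - p v‖))
    (φ := ccwAngle (p i - p v) (p j - p v) - φ) (by positivity)
    (by rw [mul_assoc, div_mul_cancel₀ _ ha.ne']; exact htr) (by linarith) (by linarith)
  convert key using 2
  have e2 : Complex.exp (((ccwAngle (p i - p v) (p j - p v) - φ : ℝ) : ℂ) * Complex.I) =
      Complex.exp ((-1 * φ : ℝ) * Complex.I) *
        Complex.exp ((ccwAngle (p i - p v) (p j - p v) : ℝ) * Complex.I) := by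
    rw [← Complex.exp_add]; congr 1; push_cast; ring
  rw [e2]
  conv_lhs => rw [e]
  push_cast
  ring

/-! ### Vertices of the polygon of a face and sectors inside the face. -/

namespace IsFacePolygon

variable {F : Set ℂ} {k : ℕ} {w : Fin k → V}

/-- A sector inside a face is the angle of its polygon at some vertex. -/
lemma exists_vertex [Finite V] (hp : InGeneralPosition p) (hN : IsNonCrossing G p)
    (hr : 0 < r) (h : IsFacePolygon G p F w) {v i j : V}
    (hc : AreConsecutive G p v i j) (hF : sectorRegion G p r v i ⊆ F) :
    ∃ m, w m = v ∧ ((i = w (finRotate k m) ∧ j = w ((finRotate k).symm m)) ∨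
      (i = w ((finRotate k).symm m) ∧ j = w (finRotate k m))) := by
  -- Both bounding edges of the sector lie in the closure of `F` near `v`, so each of them must be a
  -- side of the polygon at `v`.
  have key : ∀ i', G.Adj v i' → (∀ t : ℝ, 0 < t → t * ‖p i' - p v‖ < r →
      p v + t * (p i' - p v) ∈ closure F) →
      ∃ m, w m = v ∧ (i' = w (finRotate k m) ∨ i' = w ((finRotate k).symm m)) := by
    intro i' hi' hcl
    have hb := norm_pos_iff.2 (hp.sub_ne_zero hi'.ne')
    obtain ⟨t, ht0, ht⟩ : ∃ t : ℝ, 0 < t ∧ t < min 1 (r / ‖p i' - p v‖) :=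
      exists_between (lt_min one_pos (div_pos hr hb))
    have ht1 := ht.trans_le (min_le_left _ _)
    have htr := (lt_div_iff₀ hb).1 (ht.trans_le (min_le_right _ _))
    have hd : p v + t * (p i' - p v) ∈ drawing G p :=
      Or.inr ⟨v, i', hi', mem_segment_iff_sub.2 ⟨t, ht0.le, ht1.le, by ring⟩⟩
    obtain ⟨m, hm⟩ := mem_boundary_iff.1 (h.mem_boundary_of_mem_closure (hcl t ht0 htr) hd)
    rcases edge_eq_of_mem_segment hp hN hi' (h.adj m) ht0 ht1 hm with ⟨e1, e2⟩ | ⟨e1, e2⟩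
    · exact ⟨m, e1, Or.inl e2.symm⟩
    · refine ⟨finRotate k m, e2, Or.inr ?_⟩
      rw [Equiv.symm_apply_apply, e1]
  obtain ⟨m, hm, h1⟩ := key i hc.1 fun t ht htr => closure_mono hF (hc.mem_closure_fst hp ht htr)
  obtain ⟨m', hm', h2⟩ := key j hc.2.1
    fun t ht htr => closure_mono hF (hc.mem_closure_snd hp ht htr)
  obtain rfl : m = m' := h.injective (hm.trans hm'.symm)
  -- An edge that is consecutive to itself is the only edge at `v`, whereas a vertex of the polygon
  -- has two distinct neighbours.
  have hij : i ≠ j := by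
    rintro rfl
    have huniq : ∀ l, G.Adj v l → l = i := by
      intro l hl
      have h3 := hc.2.2 l hl
      rw [ccwAngle_self (hp.sub_ne_zero hc.1.ne')] at h3
      have h4 := h3.antisymm (ccwAngle_le _ _)
      rw [← ccwAngle_self (hp.sub_ne_zero hc.1.ne')] at h4
      obtain ⟨s, _, hs⟩ := eq_mul_of_ccwAngle_eq (hp.sub_ne_zero hc.1.ne')
        (hp.sub_ne_zero hc.1.ne') (hp.sub_ne_zero hl.ne') h4
      exact (hp.eq_of_sub_eq_mul hc.1.ne' hl.ne' hs).symm
    have e1 := h.adj m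
    have e2 := h.adj_symm m
    rw [hm] at e1 e2
    exact h.next_ne_prev m ((huniq _ e1).trans (huniq _ e2).symm)
  refine ⟨m, hm, ?_⟩
  rcases h1 with h1 | h1 <;> rcases h2 with h2 | h2
  · exact absurd (h1.trans h2.symm) hij
  · exact Or.inl ⟨h1, h2⟩
  · exact Or.inr ⟨h1, h2⟩
  · exact absurd (h1.trans h2.symm) hij

/-- At every vertex of its polygon a face contains some sector. -/
lemma exists_sector [Finite V] (hp : InGeneralPosition p) (hr : IsLocalRadius G p r)
    (h : IsFacePolygon G p F w) (m : Fin k) :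
    ∃ i, G.Adj (w m) i ∧ sectorRegion G p r (w m) i ⊆ F := by
  have hb := norm_pos_iff.2 (hp.sub_ne_zero (h.adj m).ne')
  obtain ⟨t, ht0, ht⟩ : ∃ t : ℝ, 0 < t ∧ t < min 1 (r / ‖p (w (finRotate k m)) - p (w m)‖) :=
    exists_between (lt_min one_pos (div_pos hr.1 hb))
  have ht1 := ht.trans_le (min_le_left _ _)
  have htr := (lt_div_iff₀ hb).1 (ht.trans_le (min_le_right _ _))
  obtain ⟨φ, h1, -⟩ := (h.eventually_side m ht0 ht1).exists
  have key : ∀ x ∈ F, ‖x - p (w m)‖ < r →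
      ∃ i, G.Adj (w m) i ∧ sectorRegion G p r (w m) i ⊆ F := by
    intro x hx hxr
    obtain ⟨i, hi, hxi⟩ := exists_mem_sectorRegion hp hr ⟨_, h.adj m⟩ (h.face.subset hx) hxr
    exact ⟨i, hi, h.face.subset_of_mem (isPreconnected_sectorRegion hp hi)
      (sectorRegion_subset hr _ _) hxi hx⟩
  rcases h1 with h1 | h1
  · exact key _ h1 (by rwa [add_sub_cancel_left, norm_mul_exp _ _ ht0])
  · exact key _ h1 (by rwa [add_sub_cancel_left, norm_mul_exp _ _ ht0])

/-- This excludes the remaining case of a vertex of degree two: if both of its sectors were in `F`,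
then `F` would lie on both sides of a side of its polygon. -/
lemma not_both_sides (hp : InGeneralPosition p) (hr : 0 < r)
    (h : IsFacePolygon G p F w) (m : Fin k) {b : V}
    (h1 : AreConsecutive G p (w m) (w (finRotate k m)) b)
    (h2 : AreConsecutive G p (w m) b (w (finRotate k m)))
    (hF1 : sectorRegion G p r (w m) (w (finRotate k m)) ⊆ F)
    (hF2 : sectorRegion G p r (w m) b ⊆ F) : False := by
  have hb := norm_pos_iff.2 (hp.sub_ne_zero (h.adj m).ne')
  obtain ⟨t, ht0, ht⟩ : ∃ t : ℝ, 0 < t ∧ t < min 1 (r / ‖p (w (finRotate k m)) - p (w m)‖) :=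
    exists_between (lt_min one_pos (div_pos hr hb))
  have ht1 := ht.trans_le (min_le_left _ _)
  have htr := (lt_div_iff₀ hb).1 (ht.trans_le (min_le_right _ _))
  obtain ⟨φ, ⟨⟨-, h3⟩, h4⟩, h5⟩ := (((h.eventually_side m ht0 ht1).and
    (Ioo_mem_nhdsGT (ccwAngle_pos (p (w (finRotate k m)) - p (w m)) (p b - p (w m))))).and
    (Ioo_mem_nhdsGT (ccwAngle_pos (p b - p (w m)) (p (w (finRotate k m)) - p (w m))))).exists
  refine h3 ⟨hF1 ?_, hF2 ?_⟩
  · rw [one_mul]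
    exact h1.mem_sectorRegion hp ht0 htr h4.1 h4.2
  · exact h2.mem_sectorRegion_snd hp ht0 htr h5.1 h5.2

/-- At every vertex of its polygon a face contains only one sector. -/
lemma sector_unique [Finite V] (hp : InGeneralPosition p) (hN : IsNonCrossing G p)
    (hr : 0 < r) (h : IsFacePolygon G p F w) {v i i' : V} (hi : G.Adj v i) (hi' : G.Adj v i')
    (hF : sectorRegion G p r v i ⊆ F) (hF' : sectorRegion G p r v i' ⊆ F) : i = i' := by
  obtain ⟨j, hc⟩ := exists_areConsecutive (p := p) hi
  obtain ⟨j', hc'⟩ := exists_areConsecutive (p := p) hi'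
  obtain ⟨m, rfl, h1⟩ := h.exists_vertex hp hN hr hc hF
  obtain ⟨m', hm', h2⟩ := h.exists_vertex hp hN hr hc' hF'
  obtain rfl := h.injective hm'
  rcases h1 with ⟨rfl, rfl⟩ | ⟨rfl, rfl⟩ <;> rcases h2 with ⟨rfl, rfl⟩ | ⟨rfl, rfl⟩
  · rfl
  · exact (h.not_both_sides hp hr _ hc hc' hF hF').elim
  · exact (h.not_both_sides hp hr _ hc' hc hF' hF).elim
  · rfl

/-- The convex vertices of the polygon of a face are those at which the sector of the face has an
angle smaller than `π`. -/
lemma isConvexVertex_iff [Finite V] (hp : InGeneralPosition p) (hN : IsNonCrossing G p)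
    (hr : IsLocalRadius G p r) (h : IsFacePolygon G p F w) (m : Fin k) {i j : V}
    (hc : AreConsecutive G p (w m) i j) (hF : sectorRegion G p r (w m) i ⊆ F) :
    IsConvexVertex (Polygon.mk (p ∘ w)) m ↔
      ccwAngle (p i - p (w m)) (p j - p (w m)) < Real.pi := by
  set v := w m with hv
  have ha := hp.sub_ne_zero hc.1.ne'
  have hb := hp.sub_ne_zero hc.2.1.ne'
  obtain ⟨m', hm', hij⟩ := h.exists_vertex hp hN hr.1 hc hF
  obtain rfl : m' = m := h.injective hm'
  have hne : i ≠ j := by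
    rcases hij with ⟨rfl, rfl⟩ | ⟨rfl, rfl⟩
    · exact h.next_ne_prev _
    · exact (h.next_ne_prev _).symm
  have hcr := hp.cross_ne_zero hc.1.ne' hc.2.1.ne' hne
  have hconv : IsConvexVertex (Polygon.mk (p ∘ w)) m' ↔
      ∃ ε : ℝ, 0 < ε ∧ ∀ s t : ℝ, 0 < s → s < ε → 0 < t → t < ε →
        p v + s * (p i - p v) + t * (p j - p v) ∈ F := by
    have hcol : ¬ Collinear ℝ {p (w ((finRotate k).symm m')), p v, p (w (finRotate k m'))} :=
      hp.2 _ _ _ (h.adj_symm m').ne' (h.adj m').ne (h.next_ne_prev m').symm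
    rw [IsConvexVertex]
    simp only [Complex.real_smul, Function.comp_apply, ← hv, ← h.eq]
    rw [and_iff_right hcol]
    rcases hij with ⟨rfl, rfl⟩ | ⟨rfl, rfl⟩
    · refine exists_congr fun ε => and_congr_right fun hε => ⟨fun H s t hs hs' ht ht' => ?_,
        fun H s t hs hs' ht ht' => ?_⟩
      · have := H t s ht ht' hs hs'
        convert this using 1; ring
      · have := H t s ht ht' hs hs'
        convert this using 1; ring
    · exact Iff.rfl
  rw [hconv]
  constructor
  · rintro ⟨ε, hε, H⟩
    by_contra hlt
    have hpi : Real.pi < ccwAngle (p i - p v) (p j - p v) :=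
      lt_of_le_of_ne (not_lt.1 hlt) (hc.ccwAngle_ne_pi hp).symm
    have hneg : cross (p i - p v) (p j - p v) < 0 :=
      lt_of_le_of_ne (not_lt.1 fun h => hlt ((cross_pos_iff ha hb).1 h)) hcr
    -- The sum of the two edge vectors points into the convex angle complementary to the reflex
    -- sector. Convexity of the vertex would place it in `F`, hence in the only sector of `F` at
    -- `v`, a contradiction.
    set z := (p i - p v) + (p j - p v) with hz
    have hz0 : z ≠ 0 := by
      intro e
      have h1 : cross (p i - p v) z = 0 := by rw [e, cross_zero]
      rw [hz, cross_add, cross_self, zero_add] at h1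
      exact hcr h1
    have hzn := norm_pos_iff.2 hz0
    obtain ⟨s, hs0, hs⟩ : ∃ s : ℝ, 0 < s ∧ s < min ε (r / ‖z‖) :=
      exists_between (lt_min hε (div_pos hr.1 hzn))
    have hsr := (lt_div_iff₀ hzn).1 (hs.trans_le (min_le_right _ _))
    have hs1 := hs.trans_le (min_le_left _ _)
    have hxF := H s s hs0 hs1 hs0 hs1
    have e : p v + s * (p i - p v) + s * (p j - p v) - p v = s * z := by rw [hz]; ring
    obtain ⟨i', hi', hxi'⟩ := exists_mem_sectorRegion hp hr ⟨i, hc.1⟩ (h.face.subset hxF)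
      (by rwa [e, norm_mul, Complex.norm_real, Real.norm_of_nonneg hs0.le])
    have hi'F := h.face.subset_of_mem (isPreconnected_sectorRegion hp hi')
      (sectorRegion_subset hr _ _) hxi' hxF
    obtain rfl := h.sector_unique hp hN hr.1 hc.1 hi' hF hi'F
    have hlt2 := (hc.inSector_iff.1 hxi'.2).2
    rw [e, ccwAngle_mul_left hs0] at hlt2
    have h1 : cross (p i - p v) z < 0 := by rwa [hz, cross_add, cross_self, zero_add]
    have h2 := ((cross_neg_iff ha hz0).1 h1).1
    have h3 : 0 < cross z (p j - p v) := by
      rw [cross_pos_iff hz0 hb, ccwAngle_sub ha hz0 hb hlt2]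
      have := ccwAngle_le (p i - p v) (p j - p v)
      linarith
    rw [hz, add_cross, cross_self, add_zero] at h3
    linarith
  · intro hlt
    have hpos := (cross_pos_iff ha hb).2 hlt
    have ha' := norm_pos_iff.2 ha
    have hb' := norm_pos_iff.2 hb
    refine ⟨r / (‖p i - p v‖ + ‖p j - p v‖), div_pos hr.1 (by positivity),
      fun s t hs hs' ht ht' => hF ?_⟩
    have e : p v + s * (p i - p v) + t * (p j - p v) - p v =
      s * (p i - p v) + t * (p j - p v) := by ring
    have hz0 : (s : ℂ) * (p i - p v) + t * (p j - p v) ≠ 0 := by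
      intro e
      have h1 := congrArg (cross (p i - p v)) e
      rw [cross_add, cross_mul, cross_mul, cross_self, cross_zero, mul_zero, zero_add] at h1
      exact (mul_pos ht hpos).ne' h1
    refine ⟨?_, ?_⟩
    · rw [e]
      rw [lt_div_iff₀ (by positivity)] at hs' ht'
      refine (norm_add_le _ _).trans_lt ?_
      rw [norm_mul, norm_mul, Complex.norm_real, Complex.norm_real, Real.norm_of_nonneg hs.le,
        Real.norm_of_nonneg ht.le]
      have h1 : s * ‖p i - p v‖ ≤ r / (‖p i - p v‖ + ‖p j - p v‖) * ‖p i - p v‖ := by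
        refine mul_le_mul_of_nonneg_right ?_ ha'.le
        rw [le_div_iff₀ (by positivity)]; exact hs'.le
      have h2 : t * ‖p j - p v‖ < r / (‖p i - p v‖ + ‖p j - p v‖) * ‖p j - p v‖ := by
        refine mul_lt_mul_of_pos_right ?_ hb'
        rw [lt_div_iff₀ (by positivity)]; exact ht'
      have h3 : r / (‖p i - p v‖ + ‖p j - p v‖) * ‖p i - p v‖ +
          r / (‖p i - p v‖ + ‖p j - p v‖) * ‖p j - p v‖ = r := by
        field_simp
      linarith
    · rw [hc.inSector_iff, e]
      refine ⟨hz0, ccwAngle_lt_of_cross ha hz0 hb ?_ ?_⟩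
      · rw [cross_add, cross_mul, cross_mul, cross_self, mul_zero, zero_add]
        positivity
      · rw [add_cross, mul_cross, mul_cross, cross_self, mul_zero, add_zero]
        positivity

end IsFacePolygon

end PlaneFramework

namespace PlaneFramework

variable {V : Type*} {G : SimpleGraph V} {p : V → ℂ} {r : ℝ}

/-! ### Transversal fields and counted sectors -/

/-- The angle between the edge `vi` and the next edge at `v` is larger than `π`. -/
def IsReflex (G : SimpleGraph V) (p : V → ℂ) (v i : V) : Prop :=
  ∃ j, AreConsecutive G p v i j ∧ Real.pi < ccwAngle (p i - p v) (p j - p v)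

/-- The sector at `v` starting at `vi` is convex and contains exactly one of `± u v`, or it is
reflex and contains both. -/
def IsCounted (G : SimpleGraph V) (p u : V → ℂ) (v i : V) : Prop :=
  ∃ j, AreConsecutive G p v i j ∧
    ((ccwAngle (p i - p v) (p j - p v) < Real.pi ∧
        cross (p i - p v) (u v) * cross (p j - p v) (u v) < 0) ∨
      (Real.pi < ccwAngle (p i - p v) (p j - p v) ∧
        0 < cross (p i - p v) (u v) * cross (p j - p v) (u v)))

/-- Neighbouring vectors lie on the same side of the edge, and on neither of them is the edge
parallel to the vector. -/
def IsTransversal (G : SimpleGraph V) (p u : V → ℂ) : Prop :=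
  ∀ i j, G.Adj i j → cross (p j - p i) (u i) = cross (p j - p i) (u j) ∧
    cross (p j - p i) (u i) ≠ 0

lemma exists_convex_of_not_isReflex [Finite V] (hp : InGeneralPosition p) {v i : V}
    (hi : G.Adj v i) (h : ¬ IsReflex G p v i) :
    ∃ j, AreConsecutive G p v i j ∧ ccwAngle (p i - p v) (p j - p v) < Real.pi := by
  obtain ⟨j, hc⟩ := exists_areConsecutive (p := p) hi
  exact ⟨j, hc, lt_of_le_of_ne (not_lt.1 fun h' => h ⟨j, hc, h'⟩) (hc.ccwAngle_ne_pi hp)⟩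

/-- In a convex sector membership is decided by orientations alone: left of the first edge and right
of the second. -/
lemma inSector_of_convex (hp : InGeneralPosition p) {v i j : V} (h : AreConsecutive G p v i j)
    {z : ℂ} (h1 : 0 < cross (p i - p v) z) (h2 : cross (p j - p v) z < 0) :
    InSector G p v i z := by
  have hz : z ≠ 0 := by rintro rfl; simp [cross_zero] at h1
  refine h.inSector_iff.2 ⟨hz, ccwAngle_lt_of_cross (hp.sub_ne_zero h.1.ne') hz
    (hp.sub_ne_zero h.2.1.ne') h1 ?_⟩
  rw [cross_comm]; linarith

/-- A direction outside a reflex sector lies in the complementary convex angle, where it is on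
opposite sides of the two edges or along one of them. -/
lemma inSector_of_reflex (hp : InGeneralPosition p) {v i j : V} (h : AreConsecutive G p v i j)
    (hpi : Real.pi < ccwAngle (p i - p v) (p j - p v))
    {z : ℂ} (h1 : 0 < cross (p i - p v) z * cross (p j - p v) z) :
    InSector G p v i z := by
  have hz : z ≠ 0 := by rintro rfl; simp [cross_zero] at h1
  have ha := hp.sub_ne_zero h.1.ne'
  have hb := hp.sub_ne_zero h.2.1.ne'
  refine h.inSector_iff.2 ⟨hz, ?_⟩
  by_contra hlt
  rcases (not_lt.1 hlt).lt_or_eq with h3 | h3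
  · have h4 : ccwAngle (p i - p v) z < 2 * Real.pi := by
      refine lt_of_le_of_ne (ccwAngle_le _ _) fun e => ?_
      rw [cross_eq_sin _ ha hz, e, Real.sin_two_pi] at h1
      simp at h1
    have h5 : cross (p i - p v) z < 0 := (cross_neg_iff ha hz).2 ⟨by linarith, h4⟩
    have h6 : 0 < cross (p j - p v) z := by
      rw [cross_pos_iff hb hz, ccwAngle_sub ha hb hz h3]
      linarith
    exact absurd h1 (not_lt.2 (mul_neg_of_neg_of_pos h5 h6).le)
  · obtain ⟨t, _, rfl⟩ := eq_mul_of_ccwAngle_eq ha hb hz h3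
    rw [cross_mul (p j - p v), cross_self] at h1
    simp at h1

lemma IsCounted.inSector (hp : InGeneralPosition p) {u : V → ℂ} {v i : V}
    (h : IsCounted G p u v i) : InSector G p v i (u v) ∨ InSector G p v i (-u v) := by
  obtain ⟨j, hc, ⟨_, h1⟩ | ⟨h0, h1⟩⟩ := h
  · rcases mul_neg_iff.1 h1 with ⟨h2, h3⟩ | ⟨h2, h3⟩
    · exact Or.inl (inSector_of_convex hp hc h2 h3)
    · refine Or.inr (inSector_of_convex hp hc ?_ ?_) <;> rw [cross_neg] <;> linarith
  · exact Or.inl (inSector_of_reflex hp hc h0 h1)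

lemma IsCounted.inSector_of_isReflex (hp : InGeneralPosition p) {u : V → ℂ} {v i : V}
    (h : IsCounted G p u v i) (h' : IsReflex G p v i) :
    InSector G p v i (u v) ∧ InSector G p v i (-u v) := by
  obtain ⟨j, hc, h1⟩ := h
  obtain ⟨j', hc', h2⟩ := h'
  obtain rfl := hc.unique hp hc'
  rcases h1 with ⟨h3, _⟩ | ⟨_, h3⟩
  · exact absurd h2 (not_lt.2 h3.le)
  · refine ⟨inSector_of_reflex hp hc h2 h3, inSector_of_reflex hp hc h2 ?_⟩
    rw [cross_neg, cross_neg]; linarith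

lemma IsReflex.inSector (hp : InGeneralPosition p) {u : V → ℂ} (hu : IsTransversal G p u)
    {v i : V} (h : IsReflex G p v i) : InSector G p v i (u v) ∨ InSector G p v i (-u v) := by
  obtain ⟨j, hc, h1⟩ := h
  exact InSector.or_neg hp hc h1 (hu v i hc.1).2

/-! ### The convex hull and the unbounded face -/

lemma InSector.eventually_mem {v i : V} {z : ℂ} (h : InSector G p v i z) (hr : 0 < r) :
    ∀ᶠ t : ℝ in 𝓝[>] 0, p v + t * z ∈ sectorRegion G p r v i := by
  have hz := norm_pos_iff.2 h.1
  filter_upwards [Ioo_mem_nhdsGT (div_pos hr hz)] with t ht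
  have ht' := (lt_div_iff₀ hz).1 ht.2
  have htC : (t : ℂ) ≠ 0 := by exact_mod_cast ht.1.ne'
  refine ⟨?_, ?_, fun k hk => ?_⟩
  · rwa [add_sub_cancel_left, norm_mul, Complex.norm_real, Real.norm_of_nonneg ht.1.le]
  · rw [add_sub_cancel_left]; exact mul_ne_zero htC h.1
  · rw [add_sub_cancel_left, ccwAngle_mul_left ht.1]; exact h.2 k hk

lemma eventually_mem_convexHull (v i j : V) {s t : ℝ} (hs : 0 ≤ s) (ht : 0 ≤ t) :
    ∀ᶠ τ : ℝ in 𝓝[>] 0,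
      p v + τ * (s * (p i - p v) + t * (p j - p v)) ∈ convexHull ℝ (range p) := by
  have hpos : 0 < 1 / (1 + s + t) := by positivity
  filter_upwards [Ioo_mem_nhdsGT hpos] with τ hτ
  have h1 := (lt_div_iff₀ (by positivity)).1 hτ.2
  have hτ0 := hτ.1
  have hv : ∀ v, p v ∈ convexHull ℝ (range p) := fun v =>
    subset_convexHull ℝ _ (mem_range_self v)
  have := (convex_convexHull ℝ (range p)).sum_mem (t := Finset.univ)
    (w := ![1 - τ * s - τ * t, τ * s, τ * t]) (z := ![p v, p i, p j]) ?_ ?_ ?_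
  · convert this using 1
    simp [Fin.sum_univ_three]; ring
  · intro m _
    fin_cases m
    · simp; nlinarith
    · simp; positivity
    · simp; positivity
  · simp [Fin.sum_univ_three]; ring
  · intro m _
    fin_cases m <;> simp [hv]

lemma isBounded_convexHull_range [Finite V] : Bornology.IsBounded (convexHull ℝ (range p)) :=
  isBounded_convexHull.2 (finite_range p).isBounded

/-- A face which meets the convex hull is bounded. -/
lemma IsFace.isBounded [Finite V] (hb : frontier (convexHull ℝ (range p)) ⊆ drawing G p)
    {F : Set ℂ} (hF : IsFace G p F) {x : ℂ} (hx : x ∈ F) (hxH : x ∈ convexHull ℝ (range p)) :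
    Bornology.IsBounded F := by
  refine isBounded_convexHull_range.subset (s := F) (t := convexHull ℝ (range p)) ?_
  by_contra hsub
  obtain ⟨y, hy, hyH⟩ := not_subset.1 hsub
  have hfr : ∀ z ∈ F, z ∉ frontier (convexHull ℝ (range p)) := fun z hz hzf =>
    hF.subset hz (hb hzf)
  -- The face avoids the frontier of the hull, so it is covered by two disjoint open sets, the
  -- interior and the exterior; being connected, it cannot meet both.
  have hcover : ∀ z ∈ F, z ∈ interior (convexHull ℝ (range p)) ∨
      z ∈ (closure (convexHull ℝ (range p)))ᶜ := by
    intro z hz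
    by_contra hn
    rw [not_or, notMem_compl_iff] at hn
    exact hfr z hz ⟨hn.2, hn.1⟩
  obtain ⟨z, -, hz1, hz2⟩ := hF.isPreconnected _ _ isOpen_interior isClosed_closure.isOpen_compl
    hcover ⟨x, hx, (hcover x hx).resolve_right fun h => h (subset_closure hxH)⟩
    ⟨y, hy, (hcover y hy).resolve_left fun h => hyH (interior_subset h)⟩
  exact hz2 (subset_closure (interior_subset hz1))

/-- A face which meets an open half plane disjoint from the vertices is unbounded. -/
lemma IsFace.not_isBounded {F : Set ℂ} (hF : IsFace G p F) {e : ℂ} (he : e ≠ 0) {M : ℝ}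
    (hM : ∀ v, cross e (p v) ≤ M) {x : ℂ} (hx : x ∈ F) (hxM : M < cross e x) :
    ¬ Bornology.IsBounded F := by
  have hconv : Convex ℝ {z | M < cross e z} := by
    intro y hy z hz s t hs ht hst
    simp only [mem_ofPred_eq, Complex.real_smul] at *
    rw [cross_add, cross_mul, cross_mul]
    obtain rfl : s = 1 - t := by linarith
    rcases ht.eq_or_lt with rfl | ht
    · simpa using hy
    · nlinarith
  have hd : {z | M < cross e z} ⊆ (drawing G p)ᶜ := by
    rintro z hz (⟨v, rfl⟩ | ⟨i, j, -, hzs⟩)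
    · exact absurd (hM v) (not_le.2 hz)
    · obtain ⟨t, h0, h1, e1⟩ := mem_segment_iff_sub.1 hzs
      have : z = p i + t * (p j - p i) := by linear_combination e1
      simp only [mem_ofPred_eq] at hz
      rw [this, cross_add, cross_mul, cross_sub] at hz
      nlinarith [hM i, hM j]
  have hsub := hF.subset_of_mem hconv.isPreconnected hd hxM hx
  intro hbdd
  obtain ⟨R, hR⟩ := (hbdd.subset hsub).exists_norm_le
  have hcr : cross e (Complex.I * e) = ‖e‖ ^ 2 := by
    simp only [cross, Complex.mul_re, Complex.mul_im, Complex.I_re, Complex.I_im, Complex.sq_norm,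
      Complex.normSq_apply]
    ring
  have he' := norm_pos_iff.2 he
  obtain ⟨t, ht0, ht⟩ : ∃ t : ℝ, 0 < t ∧ R + ‖x‖ < t * ‖e‖ := by
    refine ⟨(|R| + ‖x‖ + 1) / ‖e‖, by positivity, ?_⟩
    rw [div_mul_cancel₀ _ he'.ne']
    linarith [le_abs_self R]
  have h1 := hR (x + t * (Complex.I * e)) (by
    simp only [mem_ofPred_eq] at hxM ⊢
    rw [cross_add, cross_mul, hcr]
    have : 0 < t * ‖e‖ ^ 2 := by positivity
    linarith)
  have h2 := norm_sub_le (x + t * (Complex.I * e)) x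
  rw [add_sub_cancel_left, norm_mul, norm_mul, Complex.norm_I, one_mul, Complex.norm_real,
    Real.norm_of_nonneg ht0.le] at h2
  linarith

/-- A convex sector belongs to a bounded face. -/
lemma exists_bounded_face_of_convex [Finite V] (hp : InGeneralPosition p)
    (hr : IsLocalRadius G p r) (hb : frontier (convexHull ℝ (range p)) ⊆ drawing G p)
    {v i j : V} (hc : AreConsecutive G p v i j)
    (hpi : ccwAngle (p i - p v) (p j - p v) < Real.pi) :
    ∃ F, IsFace G p F ∧ Bornology.IsBounded F ∧ sectorRegion G p r v i ⊆ F := by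
  have hpos := (cross_pos_iff (hp.sub_ne_zero hc.1.ne') (hp.sub_ne_zero hc.2.1.ne')).2 hpi
  have hs : InSector G p v i ((1 : ℝ) * (p i - p v) + (1 : ℝ) * (p j - p v)) := by
    refine inSector_of_convex hp hc ?_ ?_
    · rw [cross_add, cross_mul, cross_mul, cross_self]; linarith
    · rw [cross_add, cross_mul, cross_mul, cross_self, cross_comm]; linarith
  obtain ⟨t, h1, h2⟩ := ((hs.eventually_mem hr.1).and
    (eventually_mem_convexHull (p := p) v i j zero_le_one zero_le_one)).exists
  obtain ⟨F, hF, hxF⟩ := exists_isFace (sectorRegion_subset hr _ _ h1)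
  exact ⟨F, hF, hF.isBounded hb hxF h2, hF.subset_of_mem (isPreconnected_sectorRegion hp hc.1)
    (sectorRegion_subset hr _ _) h1 hxF⟩

/-- At a vertex where a linear functional is maximal some reflex sector lies outside of all the
bounded faces. -/
lemma exists_outer_sector [Finite V] (hp : InGeneralPosition p)
    (hr : IsLocalRadius G p r) (hb : frontier (convexHull ℝ (range p)) ⊆ drawing G p)
    {v : V} (hv : ∃ k, G.Adj v k) {e : ℂ} (he : e ≠ 0)
    (hM : ∀ k, cross e (p k) ≤ cross e (p v)) :
    ∃ i j, AreConsecutive G p v i j ∧ Real.pi < ccwAngle (p i - p v) (p j - p v) ∧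
      ∀ F, IsFace G p F → sectorRegion G p r v i ⊆ F → ¬ Bornology.IsBounded F := by
  have hcr : cross e (Complex.I * e) = ‖e‖ ^ 2 := by
    simp only [cross, Complex.mul_re, Complex.mul_im, Complex.I_re, Complex.I_im, Complex.sq_norm,
      Complex.normSq_apply]
    ring
  have he' := norm_pos_iff.2 he
  have hpos : ∀ t : ℝ, 0 < t → cross e (p v) < cross e (p v + t * (Complex.I * e)) := by
    intro t ht
    rw [cross_add, cross_mul, hcr]
    have : 0 < t * ‖e‖ ^ 2 := by positivity
    linarith
  have hIe : Complex.I * e ≠ 0 := mul_ne_zero Complex.I_ne_zero he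
  -- The functional strictly increases along `I * e`, so this direction leaves the hull and is not
  -- the direction of any edge at `v`.
  obtain ⟨i, hi, hs⟩ := exists_inSector (G := G) hp hv hIe (by
    intro k _ t ht e1
    have h1 := hM k
    have h2 : cross e (Complex.I * e) = t * (cross e (p k) - cross e (p v)) := by
      rw [e1, cross_mul, cross_sub]
    rw [hcr] at h2
    have : 0 < ‖e‖ ^ 2 := by positivity
    nlinarith)
  obtain ⟨t, h1, ht⟩ := ((hs.eventually_mem hr.1).and self_mem_nhdsWithin).exists
  have key : ∀ F, IsFace G p F → sectorRegion G p r v i ⊆ F → ¬ Bornology.IsBounded F :=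
    fun F hF hsub => hF.not_isBounded he hM (hsub h1) (hpos t ht)
  obtain ⟨j, hc⟩ := exists_areConsecutive (p := p) hi
  refine ⟨i, j, hc, ?_, key⟩
  by_contra hle
  obtain ⟨F, hF, hFb, hsub⟩ := exists_bounded_face_of_convex hp hr hb hc
    (lt_of_le_of_ne (not_lt.1 hle) (hc.ccwAngle_ne_pi hp))
  exact key F hF hsub hFb

/-- The sectors outside of all bounded faces do not contain the directions to other vertices. -/
lemma not_inSector_of_outer [Finite V] (hp : InGeneralPosition p)
    (hr : IsLocalRadius G p r) (hb : frontier (convexHull ℝ (range p)) ⊆ drawing G p)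
    {v i j k : V} (hc : AreConsecutive G p v i j)
    (ho : ∀ F, IsFace G p F → sectorRegion G p r v i ⊆ F → ¬ Bornology.IsBounded F) :
    ¬ InSector G p v i (p k - p v) := by
  intro hs
  obtain ⟨t, h1, h2⟩ := ((hs.eventually_mem hr.1).and
    (eventually_mem_convexHull (p := p) v k k zero_le_one le_rfl)).exists
  obtain ⟨F, hF, hxF⟩ := exists_isFace (sectorRegion_subset hr _ _ h1)
  refine ho F hF (hF.subset_of_mem (isPreconnected_sectorRegion hp hc.1)
    (sectorRegion_subset hr _ _) h1 hxF) (hF.isBounded hb hxF ?_)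
  convert h2 using 3
  simp

/-- Every vertex lies on a bounded face, unless there are at most two vertices. -/
lemma exists_bounded_face [Finite V] (hp : InGeneralPosition p)
    (hr : IsLocalRadius G p r) (hb : frontier (convexHull ℝ (range p)) ⊆ drawing G p)
    {v x y : V} (hx : G.Adj v x) (hy : y ≠ v) (hxy : x ≠ y) :
    ∃ i F, G.Adj v i ∧ IsFace G p F ∧ Bornology.IsBounded F ∧ sectorRegion G p r v i ⊆ F := by
  have hcr := hp.cross_ne_zero hx.ne' hy hxy
  set a := p x - p v
  set b := p y - p v
  -- The direction `a + s b` points into the hull for every `s > 0`; only finitely many `s` make it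
  -- parallel to an edge at `v`.
  have hbad : {s : ℝ | ∃ k, G.Adj v k ∧ cross (p k - p v) a + s * cross (p k - p v) b = 0}.Finite := by
    have : {s : ℝ | ∃ k, G.Adj v k ∧ cross (p k - p v) a + s * cross (p k - p v) b = 0} ⊆
        range fun k => -cross (p k - p v) a / cross (p k - p v) b := by
      rintro s ⟨k, hk, e⟩
      refine ⟨k, ?_⟩
      have : cross (p k - p v) b ≠ 0 := by
        intro h0
        rw [h0, mul_zero, add_zero] at e
        exact hp.sub_ne_zero hk.ne' (eq_zero_of_cross_eq_zero hcr
          (by rw [cross_comm, e, neg_zero]) (by rw [cross_comm, h0, neg_zero]))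
      simp only
      field_simp; linarith
    exact (finite_range _).subset this
  obtain ⟨s, ⟨hs0, hs1⟩, hs⟩ := ((Ioo_infinite (zero_lt_one (α := ℝ))).sdiff hbad).nonempty
  have hz0 : (1 : ℝ) * a + s * b ≠ 0 := by
    intro e
    have := congrArg (cross a) e
    rw [cross_add, cross_mul, cross_mul, cross_self, cross_zero] at this
    simp only [mul_zero, zero_add, mul_eq_zero] at this
    rcases this with h | h
    · exact hs0.ne' h
    · exact hcr h
  obtain ⟨i, hi, hsec⟩ := exists_inSector (G := G) hp ⟨x, hx⟩ hz0 (by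
    intro k hk t ht e
    apply hs
    refine ⟨k, hk, ?_⟩
    have := congrArg (cross (p k - p v)) e
    rw [cross_add, cross_mul, cross_mul, cross_mul, cross_self] at this
    linarith)
  obtain ⟨t, h1, h2⟩ := ((hsec.eventually_mem hr.1).and
    (eventually_mem_convexHull (p := p) v x y zero_le_one hs0.le)).exists
  obtain ⟨F, hF, hxF⟩ := exists_isFace (sectorRegion_subset hr _ _ h1)
  exact ⟨i, F, hi, hF, hF.isBounded hb hxF h2, hF.subset_of_mem
    (isPreconnected_sectorRegion hp hi) (sectorRegion_subset hr _ _) h1 hxF⟩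

end PlaneFramework

namespace PlaneFramework

/-! ### The parity of the number of counted sectors in a face -/

section

open scoped Classical Finset

/-- The products `s m * s (m - 1)` taken around the cycle multiply to a square, hence to a positive
number. Comparing signs factor by factor shows that `P` and `C` hold equally often modulo `2`. -/
lemma odd_card_of_card_eq_three {k : ℕ} (s : Fin k → ℝ) (hs : ∀ m, s m ≠ 0) (C P : Fin k → Prop)
    [DecidablePred C]
    (hC : #{m | C m} = 3)
    (hP : ∀ m, P m ↔ (C m ∧ 0 < s m * s ((finRotate k).symm m)) ∨
      (¬ C m ∧ s m * s ((finRotate k).symm m) < 0)) :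
    Odd #{m | P m} := by
  set t : Fin k → ℝ := fun m => s m * s ((finRotate k).symm m) with ht
  have ht0 : ∀ m, t m ≠ 0 := fun m => mul_ne_zero (hs _) (hs _)
  have h1 : ∀ m, |t m| * (if P m then -1 else 1) = t m * (if C m then -1 else 1) := by
    intro m
    rcases (ht0 m).lt_or_gt with h | h
    · by_cases hc : C m
      · have : ¬ P m := by
          rw [hP]
          rintro (⟨_, h'⟩ | ⟨h', _⟩)
          · exact lt_asymm h h'
          · exact h' hc
        simp [this, hc, abs_of_neg h]
      · have : P m := by rw [hP]; exact Or.inr ⟨hc, h⟩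
        simp [this, hc, abs_of_neg h]
    · by_cases hc : C m
      · have : P m := by rw [hP]; exact Or.inl ⟨hc, h⟩
        simp [this, hc, abs_of_pos h]
      · have : ¬ P m := by
          rw [hP]
          rintro (⟨h', _⟩ | ⟨_, h'⟩)
          · exact hc h'
          · exact lt_asymm h h'
        simp [this, hc, abs_of_pos h]
  have h2 := Finset.prod_congr rfl fun m (_ : m ∈ Finset.univ) => h1 m
  have h3 : ∏ m, t m = (∏ m, s m) ^ 2 := by
    rw [ht, Finset.prod_mul_distrib, Equiv.prod_comp (finRotate k).symm s, sq]
  have h4 : 0 < ∏ m, t m := by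
    rw [h3]
    have : ∏ m, s m ≠ 0 := Finset.prod_ne_zero_iff.2 fun m _ => hs m
    positivity
  rw [Finset.prod_mul_distrib, Finset.prod_mul_distrib, ← Finset.abs_prod, abs_of_pos h4,
    Finset.prod_ite, Finset.prod_ite] at h2
  simp only [Finset.prod_const, one_pow, mul_one, hC] at h2
  have h5 := mul_left_cancel₀ h4.ne' h2
  by_contra hodd
  rw [Nat.not_odd_iff_even] at hodd
  rw [hodd.neg_one_pow] at h5
  norm_num at h5

variable {V : Type*} {G : SimpleGraph V} {p : V → ℂ} {r : ℝ}

namespace IsFacePolygon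

variable {F : Set ℂ} {k : ℕ} {w : Fin k → V}

lemma not_isReflex_iff [Finite V] (hp : InGeneralPosition p) (hN : IsNonCrossing G p)
    (hr : IsLocalRadius G p r) (h : IsFacePolygon G p F w) (m : Fin k) {i : V}
    (hi : G.Adj (w m) i) (hF : sectorRegion G p r (w m) i ⊆ F) :
    ¬ IsReflex G p (w m) i ↔ IsConvexVertex (Polygon.mk (p ∘ w)) m := by
  obtain ⟨j, hc⟩ := exists_areConsecutive (p := p) hi
  rw [h.isConvexVertex_iff hp hN hr m hc hF]
  constructor
  · intro h1
    exact lt_of_le_of_ne (not_lt.1 fun h2 => h1 ⟨j, hc, h2⟩) (hc.ccwAngle_ne_pi hp)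
  · rintro h1 ⟨j', hc', h2⟩
    obtain rfl := hc.unique hp hc'
    exact lt_asymm h1 h2

/-- The product of the two cross products is symmetric in the neighbours, so the direction in which
`w` runs around the face plays no role. -/
lemma isCounted_iff [Finite V] (hp : InGeneralPosition p) (hN : IsNonCrossing G p)
    (hr : IsLocalRadius G p r) (h : IsFacePolygon G p F w) {u : V → ℂ} (m : Fin k)
    {i : V} (hi : G.Adj (w m) i) (hF : sectorRegion G p r (w m) i ⊆ F) :
    IsCounted G p u (w m) i ↔
      (¬ IsReflex G p (w m) i ∧ cross (p (w (finRotate k m)) - p (w m)) (u (w m)) *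
        cross (p (w ((finRotate k).symm m)) - p (w m)) (u (w m)) < 0) ∨
      (IsReflex G p (w m) i ∧ 0 < cross (p (w (finRotate k m)) - p (w m)) (u (w m)) *
        cross (p (w ((finRotate k).symm m)) - p (w m)) (u (w m))) := by
  obtain ⟨j, hc⟩ := exists_areConsecutive (p := p) hi
  obtain ⟨m', hm', hij⟩ := h.exists_vertex hp hN hr.1 hc hF
  obtain rfl := h.injective hm'
  have e : cross (p i - p (w m')) (u (w m')) * cross (p j - p (w m')) (u (w m')) =
      cross (p (w (finRotate k m')) - p (w m')) (u (w m')) *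
        cross (p (w ((finRotate k).symm m')) - p (w m')) (u (w m')) := by
    rcases hij with ⟨rfl, rfl⟩ | ⟨rfl, rfl⟩
    · rfl
    · exact mul_comm _ _
  have h1 : IsReflex G p (w m') i ↔ Real.pi < ccwAngle (p i - p (w m')) (p j - p (w m')) := by
    constructor
    · rintro ⟨j', hc', h2⟩
      obtain rfl := hc.unique hp hc'
      exact h2
    · exact fun h2 => ⟨j, hc, h2⟩
  have h2 : ¬ IsReflex G p (w m') i ↔
      ccwAngle (p i - p (w m')) (p j - p (w m')) < Real.pi := by
    rw [h1, not_lt]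
    exact ⟨fun h => lt_of_le_of_ne h (hc.ccwAngle_ne_pi hp), le_of_lt⟩
  rw [h2, h1, ← e]
  constructor
  · rintro ⟨j', hc', h3⟩
    obtain rfl := hc.unique hp hc'
    exact h3
  · exact fun h3 => ⟨j, hc, h3⟩

/-- The vertices of the polygon of a face correspond to the sectors in this face. -/
lemma exists_equiv [Finite V] (hp : InGeneralPosition p) (hN : IsNonCrossing G p)
    (hr : IsLocalRadius G p r) (h : IsFacePolygon G p F w) :
    ∃ e : Fin k ≃ {d : G.Dart // sectorRegion G p r d.fst d.snd ⊆ F},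
      ∀ m, (e m).1.fst = w m := by
  choose i hi hF using h.exists_sector hp hr
  refine ⟨Equiv.ofBijective (fun m => ⟨⟨(w m, i m), hi m⟩, hF m⟩) ⟨?_, ?_⟩, fun m => rfl⟩
  · intro m m' e
    simp only [Subtype.mk.injEq, SimpleGraph.Dart.mk.injEq, Prod.mk.injEq] at e
    exact h.injective e.1
  · rintro ⟨⟨⟨v, l⟩, hl⟩, hlF⟩
    obtain ⟨j, hc⟩ := exists_areConsecutive (p := p) hl
    obtain ⟨m, rfl, -⟩ := h.exists_vertex hp hN hr.1 hc hlF
    refine ⟨m, ?_⟩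
    have := h.sector_unique hp hN hr.1 (hi m) hl (hF m) hlF
    simp [this]

lemma card_filter [Fintype V] (e : Fin k ≃ {d : G.Dart // sectorRegion G p r d.fst d.snd ⊆ F})
    (Q : G.Dart → Prop) [DecidablePred Q] :
    #{d : G.Dart | sectorRegion G p r d.fst d.snd ⊆ F ∧ Q d} = #{m | Q (e m).1} := by
  symm
  refine Finset.card_bij (fun m _ => (e m).1) ?_ ?_ ?_
  · intro m hm
    simp only [Finset.mem_filter, Finset.mem_univ, true_and] at hm ⊢
    exact ⟨(e m).2, hm⟩
  · intro m _ m' _ h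
    exact e.injective (Subtype.ext h)
  · intro d hd
    simp only [Finset.mem_filter, Finset.mem_univ, true_and] at hd
    exact ⟨e.symm ⟨d, hd.1⟩, by simp [hd.2], by simp⟩

lemma card_convex [Fintype V] (hp : InGeneralPosition p) (hN : IsNonCrossing G p)
    (hr : IsLocalRadius G p r) (h : IsFacePolygon G p F w)
    (h3 : {m | IsConvexVertex (Polygon.mk (p ∘ w)) m}.ncard = 3) :
    #{d : G.Dart | sectorRegion G p r d.fst d.snd ⊆ F ∧ ¬ IsReflex G p d.fst d.snd} = 3 := by
  obtain ⟨e, he⟩ := h.exists_equiv hp hN hr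
  have h6 := card_filter e fun d => ¬ IsReflex G p d.fst d.snd
  have h7 : #{m | IsConvexVertex (Polygon.mk (p ∘ w)) m} = 3 := by
    rw [← h3, ← Set.ncard_coe_finset]
    congr 1
    ext m
    simp
  rw [← h7]
  refine h6.trans (congrArg Finset.card (Finset.filter_congr fun m _ => ?_))
  have h4 := (e m).2
  have h5 := (e m).1.adj
  rw [he m] at h4 h5 ⊢
  exact h.not_isReflex_iff hp hN hr m h5 h4

/-- Here `s m` is the side of the outgoing polygon edge on which `u (w m)` lies. By transversality
the same edge, seen backwards from its other end, gives `-s m`, so being counted becomes a condition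
on consecutive signs. -/
lemma odd_card_counted [Fintype V] (hp : InGeneralPosition p) (hN : IsNonCrossing G p)
    (hr : IsLocalRadius G p r) (h : IsFacePolygon G p F w)
    (h3 : {m | IsConvexVertex (Polygon.mk (p ∘ w)) m}.ncard = 3) {u : V → ℂ}
    (hu : IsTransversal G p u) :
    Odd #{d : G.Dart | sectorRegion G p r d.fst d.snd ⊆ F ∧ IsCounted G p u d.fst d.snd} := by
  obtain ⟨e, he⟩ := h.exists_equiv hp hN hr
  rw [card_filter e]
  refine odd_card_of_card_eq_three (fun m => cross (p (w (finRotate k m)) - p (w m)) (u (w m)))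
    (fun m => (hu _ _ (h.adj m)).2) (fun m => ¬ IsReflex G p (e m).1.fst (e m).1.snd) _ ?_ ?_
  · rw [← card_filter e fun d => ¬ IsReflex G p d.fst d.snd]
    exact h.card_convex hp hN hr h3
  · intro m
    have h4 := (e m).2
    have h5 := (e m).1.adj
    rw [he m] at h4 h5 ⊢
    rw [h.isCounted_iff hp hN hr m h5 h4, not_not]
    have h6 : cross (p (w ((finRotate k).symm m)) - p (w m)) (u (w m)) =
        -cross (p (w (finRotate k ((finRotate k).symm m))) - p (w ((finRotate k).symm m)))
          (u (w ((finRotate k).symm m))) := by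
      rw [(hu _ _ (h.adj ((finRotate k).symm m))).1, Equiv.apply_symm_apply, ← cross_sub_comm]
    rw [h6]
    simp only [mul_neg, neg_lt_zero, neg_pos]

end IsFacePolygon

/-! ### The number of bounded faces -/

/-- The bounded faces of a geometric graph. -/
abbrev BoundedFace (G : SimpleGraph V) (p : V → ℂ) : Type :=
  {F : Set ℂ // IsFace G p F ∧ Bornology.IsBounded F}

lemma IsPseudoTriangulation.exists_polygon (hT : IsPseudoTriangulation G p)
    (F : BoundedFace G p) : ∃ (k : ℕ) (w : Fin k → V), IsFacePolygon G p F.1 w ∧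
      {m | IsConvexVertex (Polygon.mk (p ∘ w)) m}.ncard = 3 := by
  obtain ⟨k, w, hw, hP, hF⟩ := hT.bounded_face F.1 F.2.1 F.2.2
  exact ⟨k, w, ⟨F.2.1, hw, hP.1, hF⟩, hP.2⟩

lemma BoundedFace.eq_of_subset [Finite V] (hp : InGeneralPosition p) (hr : 0 < r)
    {F F' : BoundedFace G p} {v i : V} (hi : G.Adj v i) (h : sectorRegion G p r v i ⊆ F.1)
    (h' : sectorRegion G p r v i ⊆ F'.1) : F = F' := by
  obtain ⟨x, hx⟩ := sectorRegion_nonempty hp hr hi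
  exact Subtype.ext (F.2.1.eq_of_mem F'.2.1 (h hx) (h' hx))

lemma finite_boundedFace [Finite V] (hp : InGeneralPosition p) (hT : IsPseudoTriangulation G p) :
    Finite (BoundedFace G p) := by
  obtain ⟨r, hr⟩ := exists_isLocalRadius (G := G) hp
  have h : ∀ F : BoundedFace G p, ∃ d : G.Dart, sectorRegion G p r d.fst d.snd ⊆ F.1 := by
    intro F
    obtain ⟨k, w, hw, -⟩ := hT.exists_polygon F
    have m : Fin k := ⟨0, by have := hw.simple.1; omega⟩
    obtain ⟨i, hi, hF⟩ := hw.exists_sector hp hr m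
    exact ⟨⟨(w m, i), hi⟩, hF⟩
  choose d hd using h
  have := Fintype.ofFinite V
  refine Finite.of_injective d fun F F' e => ?_
  exact BoundedFace.eq_of_subset hp hr.1 (d F).adj (hd F) (e ▸ hd F')

/-- A sector is contained in at most one bounded face, so the faces and `O` contribute disjoint
sets. -/
lemma sum_card_le [Fintype V] [Fintype (BoundedFace G p)] (hp : InGeneralPosition p) (hr : 0 < r)
    (Q : G.Dart → Prop) (O : Finset G.Dart) (hO : ∀ d ∈ O, Q d ∧
      ∀ F : BoundedFace G p, ¬ sectorRegion G p r d.fst d.snd ⊆ F.1) :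
    ∑ F : BoundedFace G p, #{d : G.Dart | sectorRegion G p r d.fst d.snd ⊆ F.1 ∧ Q d} + O.card ≤
      #{d : G.Dart | Q d} := by
  rw [← Finset.card_biUnion, ← Finset.card_union_of_disjoint]
  · refine Finset.card_le_card fun d hd => ?_
    simp only [Finset.mem_union, Finset.mem_biUnion, Finset.mem_filter, Finset.mem_univ,
      true_and] at hd ⊢
    rcases hd with ⟨F, _, h⟩ | h
    · exact h
    · exact (hO d h).1
  · rw [Finset.disjoint_left]
    intro d hd hdO
    simp only [Finset.mem_biUnion, Finset.mem_filter, Finset.mem_univ, true_and] at hd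
    obtain ⟨F, h, _⟩ := hd
    exact (hO d hdO).2 F h
  · intro F _ F' _ hne
    rw [Function.onFun, Finset.disjoint_left]
    intro d hd hd'
    simp only [Finset.mem_filter, Finset.mem_univ, true_and] at hd hd'
    exact hne (BoundedFace.eq_of_subset hp hr d.adj hd.1 hd'.1)

/-! ### Double counting of convex, reflex and counted sectors. -/

/-- Every convex sector belongs to one of the bounded faces, which have three of them each. -/
lemma card_dart_eq [Fintype V] [Fintype (BoundedFace G p)] (hp : InGeneralPosition p)
    (hT : IsPseudoTriangulation G p) :
    3 * Fintype.card (BoundedFace G p) + #{d : G.Dart | IsReflex G p d.fst d.snd} =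
      Fintype.card G.Dart := by
  obtain ⟨r, hr⟩ := exists_isLocalRadius (G := G) hp
  have h1 : #{d : G.Dart | ¬ IsReflex G p d.fst d.snd} = 3 * Fintype.card (BoundedFace G p) := by
    have h2 : ∀ F : BoundedFace G p, #{d : G.Dart | sectorRegion G p r d.fst d.snd ⊆ F.1 ∧
        ¬ IsReflex G p d.fst d.snd} = 3 := by
      intro F
      obtain ⟨k, w, hw, h3⟩ := hT.exists_polygon F
      exact hw.card_convex hp hT.nonCrossing hr h3
    have h4 : ({d : G.Dart | ¬ IsReflex G p d.fst d.snd} : Finset G.Dart) =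
        Finset.univ.biUnion fun F : BoundedFace G p => {d : G.Dart |
          sectorRegion G p r d.fst d.snd ⊆ F.1 ∧ ¬ IsReflex G p d.fst d.snd} := by
      ext d
      simp only [Finset.mem_biUnion, Finset.mem_filter, Finset.mem_univ, true_and]
      constructor
      · intro h
        obtain ⟨j, hc, hpi⟩ := exists_convex_of_not_isReflex hp d.adj h
        obtain ⟨F, hF, hFb, hsub⟩ := exists_bounded_face_of_convex hp hr hT.hull_boundary hc hpi
        exact ⟨⟨F, hF, hFb⟩, hsub, h⟩
      · rintro ⟨F, _, h⟩
        exact h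
    rw [h4, Finset.card_biUnion, Finset.sum_congr rfl fun F _ => h2 F]
    · simp [mul_comm]
    · intro F _ F' _ hne
      rw [Function.onFun, Finset.disjoint_left]
      intro d hd hd'
      simp only [Finset.mem_filter, Finset.mem_univ, true_and] at hd hd'
      exact hne (BoundedFace.eq_of_subset hp hr.1 d.adj hd.1 hd'.1)
  have h5 := Finset.card_filter_add_card_filter_not (s := (Finset.univ : Finset G.Dart))
    (fun d => IsReflex G p d.fst d.snd)
  rw [Finset.card_univ] at h5
  omega

/-- Each vertex has at most two counted sectors, and at most one if it is pointed. -/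
lemma card_counted_add_card_reflex_le [Fintype V] (hp : InGeneralPosition p) {u : V → ℂ}
    (hu : IsTransversal G p u) :
    #{d : G.Dart | IsCounted G p u d.fst d.snd} + #{d : G.Dart | IsReflex G p d.fst d.snd} ≤
      2 * Fintype.card V := by
  have h1 : ∀ z : V → ℂ, #{d : G.Dart | InSector G p d.fst d.snd (z d.fst)} ≤ Fintype.card V := by
    intro z
    rw [← Finset.card_univ]
    refine Finset.card_le_card_of_injOn (fun d => d.fst) (fun _ _ => Finset.mem_coe.2
      (Finset.mem_univ _)) ?_
    rintro ⟨⟨v, i⟩, hi⟩ h ⟨⟨v', i'⟩, hi'⟩ h' e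
    simp only [Finset.coe_filter, Finset.mem_univ, true_and, mem_ofPred_eq] at h h' e
    subst e
    obtain rfl := InSector.unique hp hi hi' h h'
    rfl
  have h2 := h1 u
  have h3 := h1 (-u)
  -- Sector by sector: one that is counted or reflex contains `u v` or `-u v`, and one that is both
  -- contains both.
  have h4 : #{d : G.Dart | IsCounted G p u d.fst d.snd} +
      #{d : G.Dart | IsReflex G p d.fst d.snd} ≤
      #{d : G.Dart | InSector G p d.fst d.snd (u d.fst)} +
      #{d : G.Dart | InSector G p d.fst d.snd ((-u) d.fst)} := by
    simp only [Finset.card_filter]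
    rw [← Finset.sum_add_distrib, ← Finset.sum_add_distrib]
    refine Finset.sum_le_sum fun d _ => ?_
    by_cases hc : IsCounted G p u d.fst d.snd <;> by_cases hR : IsReflex G p d.fst d.snd
    · obtain ⟨h5, h6⟩ := hc.inSector_of_isReflex hp hR
      simp [hc, hR, h5, h6]
    · rcases hc.inSector hp with h5 | h5 <;> simp [hc, hR, h5]
    · rcases hR.inSector hp hu with h5 | h5 <;> simp [hc, hR, h5]
    · simp [hc, hR]
  omega

end

end PlaneFramework

namespace PlaneFramework

section

open scoped Classical Finset

variable {V : Type*} {G : SimpleGraph V} {p : V → ℂ} {r : ℝ}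

/-! ### Boundary cycles of faces -/

/-- The directed sides of a closed walk. -/
def sideDart {k : ℕ} {w : Fin k → V} (hw : ∀ m, G.Adj (w m) (w (finRotate k m))) (m : Fin k) :
    G.Dart := ⟨(w m, w (finRotate k m)), hw m⟩

/-- The antisymmetric function on the darts given by a closed walk. -/
noncomputable def cycleFun {k : ℕ} {w : Fin k → V}
    (hw : ∀ m, G.Adj (w m) (w (finRotate k m))) (d : G.Dart) : ℝ :=
  ∑ m, ((if sideDart hw m = d then 1 else 0) - (if sideDart hw m = d.symm then 1 else 0))

lemma cycleFun_symm {k : ℕ} {w : Fin k → V} (hw : ∀ m, G.Adj (w m) (w (finRotate k m)))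
    (d : G.Dart) : cycleFun hw d.symm = -cycleFun hw d := by
  simp only [cycleFun, SimpleGraph.Dart.symm_symm, ← Finset.sum_neg_distrib, neg_sub]

/-- The factor `2` appears because each side contributes at both of its darts, with equal amounts
since both functions are antisymmetric. -/
lemma sum_cycleFun_mul [Fintype V] {k : ℕ} {w : Fin k → V}
    (hw : ∀ m, G.Adj (w m) (w (finRotate k m))) (g : G.Dart → ℝ)
    (hg : ∀ d, g d.symm = -g d) :
    ∑ d, cycleFun hw d * g d = 2 * ∑ m, g (sideDart hw m) := by
  simp only [cycleFun, Finset.sum_mul]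
  rw [Finset.sum_comm, Finset.mul_sum]
  refine Finset.sum_congr rfl fun m _ => ?_
  simp only [sub_mul, ite_mul, one_mul, zero_mul, Finset.sum_sub_distrib]
  have h1 : ∀ d : G.Dart, sideDart hw m = d.symm ↔ (sideDart hw m).symm = d := by
    intro d
    constructor
    · intro h; rw [h, SimpleGraph.Dart.symm_symm]
    · rintro rfl; rw [SimpleGraph.Dart.symm_symm]
  simp only [h1, Finset.sum_ite_eq, Finset.mem_univ, if_true, hg]
  ring

lemma arg_div_symm {a b x : ℂ} (h : x ∉ segment ℝ a b) :
    Complex.arg ((a - x) / (b - x)) = -Complex.arg ((b - x) / (a - x)) := by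
  rw [← inv_div, Complex.arg_inv, if_neg (Complex.slitPlane_arg_ne_pi (div_mem_slitPlane h))]

/-- The boundary cycles of the bounded faces are linearly independent, which yields one half of
Euler's formula. -/
lemma card_boundedFace_add_card_le [Fintype V] [Fintype (BoundedFace G p)]
    (hT : IsPseudoTriangulation G p) :
    Fintype.card (BoundedFace G p) + Fintype.card V ≤ Fintype.card G.edgeSet + 1 := by
  choose k w hw _ using hT.exists_polygon
  -- The source has dimension `f + n + e` and the target `2e`. A kernel of dimension at most one,
  -- consisting of constant potentials on `V`, yields the inequality.
  let T : (BoundedFace G p → ℝ) × (V → ℝ) × (G.edgeSet → ℝ) →ₗ[ℝ] (G.Dart → ℝ) :=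
    { toFun := fun q d => ∑ F, q.1 F * cycleFun (hw F).adj d + (q.2.1 d.snd - q.2.1 d.fst) +
        q.2.2 ⟨d.edge, d.edge_mem⟩
      map_add' := by
        intro q q'
        ext d
        simp only [Prod.fst_add, Prod.snd_add, Pi.add_apply, add_mul, Finset.sum_add_distrib]
        ring
      map_smul' := by
        intro c q
        ext d
        simp only [Prod.smul_fst, Prod.smul_snd, Pi.smul_apply, smul_eq_mul, RingHom.id_apply,
          mul_add, Finset.mul_sum, mul_assoc]
        ring }
  have hker : LinearMap.ker T ≤ Submodule.span ℝ {(0, fun _ => 1, 0)} := by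
    rintro ⟨x, y, z⟩ hq
    have hq' : ∀ d : G.Dart, ∑ F, x F * cycleFun (hw F).adj d + (y d.snd - y d.fst) +
        z ⟨d.edge, d.edge_mem⟩ = 0 := fun d => congrFun (LinearMap.mem_ker.1 hq) d
    -- Cycles and gradients are antisymmetric under reversal of darts and the edge term is
    -- symmetric, so the latter vanishes separately.
    have hz : z = 0 := by
      ext ⟨e, he⟩
      induction e with | h a b =>
      have h1 := hq' ⟨(a, b), he⟩
      have h2 := hq' (SimpleGraph.Dart.symm ⟨(a, b), he⟩)
      have h3 : (⟨(SimpleGraph.Dart.symm ⟨(a, b), he⟩ : G.Dart).edge,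
          SimpleGraph.Dart.edge_mem _⟩ : G.edgeSet) = ⟨s(a, b), he⟩ :=
        Subtype.ext (SimpleGraph.Dart.edge_symm _)
      rw [h3] at h2
      simp only [cycleFun_symm, mul_neg, Finset.sum_neg_distrib] at h2
      have h4 : (⟨(⟨(a, b), he⟩ : G.Dart).edge, SimpleGraph.Dart.edge_mem _⟩ : G.edgeSet) =
        ⟨s(a, b), he⟩ := rfl
      rw [h4] at h1
      simp only [SimpleGraph.Dart.symm, Prod.fst_swap, Prod.snd_swap, Pi.zero_apply] at h1 h2 ⊢
      linarith
    subst hz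
    simp only [Pi.zero_apply, add_zero] at hq'
    -- Gradients are orthogonal to cycles, so a gradient that is also a combination of cycles has
    -- norm zero.
    have hy : ∀ d : G.Dart, y d.snd = y d.fst := by
      have h1 : ∑ d : G.Dart, (y d.snd - y d.fst) ^ 2 = 0 := by
        have h2 : ∀ d : G.Dart, (y d.snd - y d.fst) ^ 2 =
            -∑ F, x F * (cycleFun (hw F).adj d * (y d.snd - y d.fst)) := by
          intro d
          simp only [← mul_assoc, ← Finset.sum_mul]
          linear_combination (y d.snd - y d.fst) * hq' d
        rw [Finset.sum_congr rfl fun d _ => h2 d, Finset.sum_neg_distrib, Finset.sum_comm,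
          neg_eq_zero]
        refine Finset.sum_eq_zero fun F _ => ?_
        rw [← Finset.mul_sum, sum_cycleFun_mul _ (fun d : G.Dart => y d.snd - y d.fst)
          (fun d => by simp [SimpleGraph.Dart.symm])]
        have : ∑ m, (y (w F (finRotate _ m)) - y (w F m)) = 0 := by
          rw [Finset.sum_sub_distrib, Equiv.sum_comp (finRotate (k F)) fun m => y (w F m), sub_self]
        simp only [sideDart]
        rw [this, mul_zero, mul_zero]
      rw [Finset.sum_eq_zero_iff_of_nonneg fun d _ => sq_nonneg _] at h1
      intro d
      have := h1 d (Finset.mem_univ d)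
      rw [sq_eq_zero_iff, sub_eq_zero] at this
      exact this
    have hconst : ∀ a b : V, y a = y b := by
      intro a b
      obtain ⟨W⟩ := hT.connected.preconnected a b
      induction W with
      | nil => rfl
      | cons hab _ ih => exact (hy ⟨(_, _), hab⟩).symm.trans ih
    -- Pairing with the angle subtended by each dart at a point `o` of `F₀` turns every cycle into
    -- twice its winding around `o`, which is nonzero for `F₀` only.
    have hx : x = 0 := by
      ext F₀
      obtain ⟨o, ho⟩ := F₀.2.1.nonempty
      have hod := F₀.2.1.subset ho
      have hoseg : ∀ d : G.Dart, o ∉ segment ℝ (p d.fst) (p d.snd) := fun d h =>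
        hod (Or.inr ⟨_, _, d.adj, h⟩)
      have h1 : ∀ F : BoundedFace G p, ∑ d : G.Dart, cycleFun (hw F).adj d *
          Complex.arg ((p d.snd - o) / (p d.fst - o)) =
          2 * winding (Polygon.mk (p ∘ w F)) o := by
        intro F
        rw [sum_cycleFun_mul (hw F).adj
          (fun d : G.Dart => Complex.arg ((p d.snd - o) / (p d.fst - o)))
          fun d => arg_div_symm (hoseg d)]
        rfl
      have h2 : ∑ F, x F * (2 * winding (Polygon.mk (p ∘ w F)) o) = 0 := by
        simp only [← h1, Finset.mul_sum]
        rw [Finset.sum_comm]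
        refine Finset.sum_eq_zero fun d _ => ?_
        have h3 := hq' d
        rw [hy d, sub_self, add_zero] at h3
        simp only [← mul_assoc, ← Finset.sum_mul]
        rw [h3, zero_mul]
      rw [Finset.sum_eq_single F₀] at h2
      · have h4 := (hw F₀).winding_ne_zero ho
        rcases mul_eq_zero.1 h2 with h5 | h5
        · exact h5
        · exact absurd h5 (mul_ne_zero two_ne_zero h4)
      · intro F _ hne
        rw [(hw F).winding_eq_zero hod, mul_zero, mul_zero]
        intro hoF
        exact hne (Subtype.ext (F.2.1.eq_of_mem F₀.2.1 hoF ho))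
      · intro h; exact absurd (Finset.mem_univ _) h
    subst hx
    obtain ⟨v⟩ := hT.connected.nonempty
    refine Submodule.mem_span_singleton.2 ⟨y v, ?_⟩
    ext a
    · simp
    · simp [hconst a v]
    · simp
  have h1 := LinearMap.finrank_range_add_finrank_ker T
  have h2 := Submodule.finrank_le (LinearMap.range T)
  have h3 := (Submodule.finrank_mono hker).trans ((finrank_span_le_card _).trans_eq (by simp : _ = 1))
  have h4 := G.dart_card_eq_twice_card_edges
  have h5 : Fintype.card G.edgeSet = #G.edgeFinset := by
    rw [SimpleGraph.edgeFinset, Set.toFinset_card]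
  simp only [Module.finrank_prod, Module.finrank_pi] at h1 h2
  omega

end

end PlaneFramework

namespace PlaneFramework

/-! ### Generic choices -/

lemma exists_generic {ι : Type*} [Finite ι] (α β : ι → ℝ) (h : ∀ i, α i ≠ 0 ∨ β i ≠ 0)
    {S : Set ℝ} (hS : S.Infinite) : ∃ s ∈ S, ∀ i, α i + s * β i ≠ 0 := by
  have hbad : {s : ℝ | ∃ i, α i + s * β i = 0}.Finite := by
    refine (finite_range fun i => -α i / β i).subset ?_
    rintro s ⟨i, e⟩
    refine ⟨i, ?_⟩
    have : β i ≠ 0 := by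
      intro h0
      rw [h0, mul_zero, add_zero] at e
      exact (h i).elim (fun h => h e) fun h => h h0
    simp only
    field_simp; linarith
  obtain ⟨s, hs, hs'⟩ := (hS.sdiff hbad).nonempty
  exact ⟨s, hs, fun i e => hs' ⟨i, e⟩⟩

/-- In the basis `A`, `B` the two sign conditions fix the signs of the coordinates of `δ`. The free
positive parameter `s` serves to avoid the finitely many directions `D i`. -/
lemma exists_generic_vector {ι : Type*} [Finite ι] (D : ι → ℂ) (hD : ∀ i, D i ≠ 0) {A B : ℂ}
    (hAB : cross A B ≠ 0) {σ τ : ℝ} (hσ : σ ≠ 0) (hτ : τ ≠ 0) :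
    ∃ δ, 0 < cross A δ * σ ∧ 0 < cross B δ * τ ∧ ∀ i, cross (D i) δ ≠ 0 := by
  obtain ⟨s, hs, hs'⟩ := exists_generic (fun i => σ / cross A B * cross (D i) B)
    (fun i => -τ / cross A B * cross (D i) A) (fun i => by
      by_contra hn
      push Not at hn
      obtain ⟨h1, h2⟩ := hn
      have h3 : cross (D i) B = 0 := (mul_eq_zero.1 h1).resolve_left (div_ne_zero hσ hAB)
      have h4 : cross (D i) A = 0 :=
        (mul_eq_zero.1 h2).resolve_left (div_ne_zero (neg_ne_zero.2 hτ) hAB)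
      exact hD i (eq_zero_of_cross_eq_zero hAB (by rw [cross_comm, h4, neg_zero])
        (by rw [cross_comm, h3, neg_zero]))) (Ioi_infinite (0 : ℝ))
  refine ⟨((σ / cross A B : ℝ) : ℂ) * B + ((s * (-τ / cross A B) : ℝ) : ℂ) * A, ?_, ?_, fun i => ?_⟩
  · rw [cross_add, cross_mul, cross_mul, cross_self, mul_zero, add_zero, div_mul_cancel₀ _ hAB]
    exact mul_self_pos.2 hσ
  · rw [cross_add, cross_mul, cross_mul, cross_self, mul_zero, zero_add, cross_comm B A]
    have : s * (-τ / cross A B) * -cross A B * τ = s * τ ^ 2 := by field_simp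
    rw [this]
    have := mem_Ioi.1 hs
    positivity
  · rw [cross_add, cross_mul, cross_mul]
    convert hs' i using 2
    ring

variable {V : Type*} {G : SimpleGraph V} {p : V → ℂ} {r : ℝ}

lemma exists_generic_direction [Finite V] (hp : InGeneralPosition p) :
    ∃ e : ℂ, ∀ i j, i ≠ j → cross (p i - p j) e ≠ 0 := by
  obtain ⟨e, _, _, h⟩ := exists_generic_vector (A := 1) (B := Complex.I)
    (fun q : {q : V × V // q.1 ≠ q.2} => p q.1.1 - p q.1.2) (fun q => hp.sub_ne_zero q.2)
    (by simp [cross]) one_ne_zero one_ne_zero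
  exact ⟨e, fun i j hij => h ⟨(i, j), hij⟩⟩

/-! ### Counting -/

section

open scoped Classical Finset

/-- A transversal field with two counted sectors in a bounded face has no counted sectors outside
of the bounded faces. -/
lemma false_of_isCounted [Fintype V] (hp : InGeneralPosition p) (hr : IsLocalRadius G p r)
    (hT : IsPseudoTriangulation G p) {u : V → ℂ} (hu : IsTransversal G p u)
    (F : BoundedFace G p) {d₁ d₂ : G.Dart} (hd : d₁ ≠ d₂)
    (h₁ : sectorRegion G p r d₁.fst d₁.snd ⊆ F.1) (h₂ : sectorRegion G p r d₂.fst d₂.snd ⊆ F.1)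
    (hc₁ : IsCounted G p u d₁.fst d₁.snd) (hc₂ : IsCounted G p u d₂.fst d₂.snd)
    {d : G.Dart} (hdc : IsCounted G p u d.fst d.snd)
    (hdo : ∀ F : BoundedFace G p, ¬ sectorRegion G p r d.fst d.snd ⊆ F.1) : False := by
  have := finite_boundedFace hp hT
  have := Fintype.ofFinite (BoundedFace G p)
  have h1 := sum_card_le hp hr.1 (fun d => IsCounted G p u d.fst d.snd) {d}
    (by simp only [Finset.mem_singleton, forall_eq]; exact ⟨hdc, hdo⟩)
  have h2 := card_counted_add_card_reflex_le hp hu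
  have h3 := card_dart_eq hp hT
  have h4 := card_boundedFace_add_card_le hT
  have h5 := G.dart_card_eq_twice_card_edges
  have h6 : Fintype.card G.edgeSet = #G.edgeFinset := by
    rw [SimpleGraph.edgeFinset, Set.toFinset_card]
  have hodd : ∀ F : BoundedFace G p, Odd #{d : G.Dart | sectorRegion G p r d.fst d.snd ⊆ F.1 ∧
      IsCounted G p u d.fst d.snd} := by
    intro F
    obtain ⟨k, w, hw, hw3⟩ := hT.exists_polygon F
    exact hw.odd_card_counted hp hT.nonCrossing hr hw3 hu
  have h7 : 3 ≤ #{d : G.Dart | sectorRegion G p r d.fst d.snd ⊆ F.1 ∧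
      IsCounted G p u d.fst d.snd} := by
    have h8 : 1 < #{d : G.Dart | sectorRegion G p r d.fst d.snd ⊆ F.1 ∧
        IsCounted G p u d.fst d.snd} :=
      Finset.one_lt_card.2 ⟨d₁, by simp [h₁, hc₁], d₂, by simp [h₂, hc₂], hd⟩
    obtain ⟨l, hl⟩ := hodd F
    omega
  have h8 : Fintype.card (BoundedFace G p) + 2 ≤ ∑ F : BoundedFace G p,
      #{d : G.Dart | sectorRegion G p r d.fst d.snd ⊆ F.1 ∧ IsCounted G p u d.fst d.snd} := by
    rw [← Finset.add_sum_erase _ _ (Finset.mem_univ F)]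
    have h9 : #(Finset.univ.erase F) ≤ ∑ F ∈ Finset.univ.erase F,
        #{d : G.Dart | sectorRegion G p r d.fst d.snd ⊆ F.1 ∧ IsCounted G p u d.fst d.snd} := by
      rw [Finset.card_eq_sum_ones]
      exact Finset.sum_le_sum fun F _ => (hodd F).pos
    rw [Finset.card_erase_of_mem (Finset.mem_univ F), Finset.card_univ] at h9
    have : 0 < Fintype.card (BoundedFace G p) := Fintype.card_pos_iff.2 ⟨F⟩
    omega
  rw [Finset.card_singleton] at h1
  -- The estimates give `κ ≤ 2n - ρ = 2n - 2e + 3f ≤ f + 2`, while the face `F` and the outer sector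
  -- `d` give `κ ≥ f + 3`.
  omega

/-- A vertex where a linear functional has a strict maximum has a counted outer sector with respect
to the field which is constant in the direction of the kernel. -/
lemma exists_outer_counted [Finite V] (hp : InGeneralPosition p) (hr : IsLocalRadius G p r)
    (hT : IsPseudoTriangulation G p) {v : V} (hv : ∃ k, G.Adj v k) {e : ℂ} (he : e ≠ 0)
    (hM : ∀ k, cross e (p k) ≤ cross e (p v)) (hM' : ∀ k, k ≠ v → cross (p k - p v) e ≠ 0) :
    ∃ i, ∃ _ : G.Adj v i, IsCounted G p (fun _ => e) v i ∧
      ∀ F : BoundedFace G p, ¬ sectorRegion G p r v i ⊆ F.1 := by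
  obtain ⟨i, j, hc, hpi, ho⟩ := exists_outer_sector hp hr hT.hull_boundary hv he hM
  refine ⟨i, hc.1, ⟨j, hc, Or.inr ⟨hpi, ?_⟩⟩, fun F hF => ho F.1 F.2.1 hF F.2.2⟩
  have key : ∀ k, k ≠ v → 0 < cross (p k - p v) e := by
    intro k hk
    refine lt_of_le_of_ne ?_ (hM' k hk).symm
    rw [cross_comm, cross_sub]
    linarith [hM k]
  exact mul_pos (key i hc.1.ne') (key j hc.2.1.ne')

lemma IsPseudoTriangulation.exists_adj (hT : IsPseudoTriangulation G p) {v i : V} (h : i ≠ v) :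
    ∃ k, G.Adj v k := by
  have : Nontrivial V := ⟨i, v, h⟩
  exact SimpleGraph.Preconnected.exists_adj_of_nontrivial hT.connected.preconnected v

/-- A pointed pseudo-triangulation has at most `2n - 3` edges. -/
lemma card_edgeSet_add_three_le [Fintype V] (hn : 2 ≤ Fintype.card V) (hp : InGeneralPosition p)
    (hT : IsPseudoTriangulation G p) (hpt : ∀ v, IsPointedAt G p v) :
    Fintype.card G.edgeSet + 3 ≤ 2 * Fintype.card V := by
  obtain ⟨r, hr⟩ := exists_isLocalRadius (G := G) hp
  have : Nontrivial V := Fintype.one_lt_card_iff_nontrivial.1 (by omega)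
  have := finite_boundedFace hp hT
  have := Fintype.ofFinite (BoundedFace G p)
  obtain ⟨e, he⟩ := exists_generic_direction hp
  have he0 : e ≠ 0 := by
    rintro rfl
    obtain ⟨i, j, hij⟩ := exists_pair_ne V
    exact he i j hij (cross_zero _)
  have hu : IsTransversal G p fun _ => e := fun i j hij => ⟨rfl, he j i hij.ne'⟩
  obtain ⟨v₁, hv₁⟩ := Finite.exists_max fun v => cross e (p v)
  obtain ⟨v₂, hv₂⟩ := Finite.exists_min fun v => cross e (p v)
  have hne : v₁ ≠ v₂ := by
    rintro rfl
    obtain ⟨i, hi⟩ := exists_ne v₁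
    apply he i v₁ hi
    rw [cross_comm, cross_sub, le_antisymm (hv₁ i) (hv₂ i), sub_self, neg_zero]
  have hnb : ∀ v, ∃ k, G.Adj v k := fun v => (exists_ne v).elim fun i hi => hT.exists_adj hi
  obtain ⟨i₁, ha₁, hc₁, ho₁⟩ := exists_outer_counted hp hr hT (hnb v₁) he0 hv₁
    fun k hk => he k v₁ hk
  obtain ⟨i₂, ha₂, hc₂, ho₂⟩ := exists_outer_counted hp hr hT (hnb v₂) (neg_ne_zero.2 he0)
    (fun k => by rw [neg_cross, neg_cross]; linarith [hv₂ k])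
    (fun k hk => by rw [cross_neg]; exact neg_ne_zero.2 (he k v₂ hk))
  -- Being counted depends only on the line spanned by the field, so `-e` may be replaced by `e`.
  replace hc₂ : IsCounted G p (fun _ => e) v₂ i₂ := by
    obtain ⟨j, hj, h⟩ := hc₂
    refine ⟨j, hj, ?_⟩
    simpa only [cross_neg, neg_mul_neg] using h
  let d₁ : G.Dart := ⟨(v₁, i₁), ha₁⟩
  let d₂ : G.Dart := ⟨(v₂, i₂), ha₂⟩
  have hd : d₁ ≠ d₂ := fun h => hne (congrArg (fun d : G.Dart => d.fst) h)
  have h1 := sum_card_le hp hr.1 (fun d => IsCounted G p (fun _ => e) d.fst d.snd) {d₁, d₂} (by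
    simp only [Finset.mem_insert, Finset.mem_singleton, forall_eq_or_imp, forall_eq]
    exact ⟨⟨hc₁, ho₁⟩, hc₂, ho₂⟩)
  rw [Finset.card_pair hd] at h1
  have h2 := card_counted_add_card_reflex_le hp hu
  have h3 := card_dart_eq hp hT
  have h5 := G.dart_card_eq_twice_card_edges
  have h6 : Fintype.card G.edgeSet = #G.edgeFinset := by
    rw [SimpleGraph.edgeFinset, Set.toFinset_card]
  have h7 : Fintype.card (BoundedFace G p) ≤ ∑ F : BoundedFace G p,
      #{d : G.Dart | sectorRegion G p r d.fst d.snd ⊆ F.1 ∧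
        IsCounted G p (fun _ => e) d.fst d.snd} := by
    rw [← Finset.card_univ, Finset.card_eq_sum_ones]
    refine Finset.sum_le_sum fun F _ => ?_
    obtain ⟨k, w, hw, hw3⟩ := hT.exists_polygon F
    exact (hw.odd_card_counted hp hT.nonCrossing hr hw3 hu).pos
  have h8 : Fintype.card V ≤ #{d : G.Dart | IsReflex G p d.fst d.snd} := by
    choose i j hij hpi using hpt
    rw [← Finset.card_univ]
    refine Finset.card_le_card_of_injOn (fun v => ⟨(v, i v), (hij v).1⟩) ?_ ?_
    · intro v _
      simp only [Finset.coe_filter, Finset.mem_univ, true_and, mem_ofPred_eq]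
      exact ⟨j v, hij v, hpi v⟩
    · intro v _ v' _ h
      exact congrArg (fun d : G.Dart => d.fst) h
  -- From `f + 2 + ρ ≤ 2n` and `ρ ≥ n` one gets `f ≤ n - 2`, hence `2e = 2f + (f + ρ) ≤ 2(n - 2) +
  -- (2n - 2) = 4n - 6`.
  omega

end

/-! ### Parallel motions -/

/-- If `i` is a vertex of the convex hull then the relative velocity of `i` and any other vertex is
the same as if they were joined by an edge. -/
lemma cross_eq_zero_of_hull [Fintype V] (hp : InGeneralPosition p)
    (hT : IsPseudoTriangulation G p) {w : V → ℂ}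
    (hw : ∀ i j, G.Adj i j → cross (p j - p i) (w j - w i) = 0) {v i : V} (hvi : i ≠ v)
    {e : ℂ} (he : e ≠ 0) (hM : ∀ k, cross e (p k) ≤ cross e (p i)) :
    cross (p i - p v) (w i - w v) = 0 := by
  obtain ⟨r, hr⟩ := exists_isLocalRadius (G := G) hp
  by_contra hne
  have hnadj : ¬ G.Adj v i := fun h => hne (hw v i h)
  obtain ⟨j, k, hc, hpi, ho⟩ := exists_outer_sector hp hr hT.hull_boundary
    (hT.exists_adj hvi.symm) he hM
  have hjv : j ≠ v := by rintro rfl; exact hnadj hc.1.symm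
  have hkv : k ≠ v := by rintro rfl; exact hnadj hc.2.1.symm
  set a := p j - p i with ha
  set b := p k - p i with hb
  set z := p v - p i with hz
  have ha0 : a ≠ 0 := hp.sub_ne_zero hc.1.ne'
  have hb0 : b ≠ 0 := hp.sub_ne_zero hc.2.1.ne'
  have hz0 : z ≠ 0 := hp.sub_ne_zero hvi.symm
  have hbz0 : cross b z ≠ 0 := hp.cross_ne_zero hc.2.1.ne' hvi.symm hkv
  have haz0 : cross a z ≠ 0 := hp.cross_ne_zero hc.1.ne' hvi.symm hjv
  -- No vertex is seen from `i` inside the outer sector, so `v` lies strictly within the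
  -- complementary convex angle; the signs of `cross a z` and `cross b z` follow.
  have hge : ccwAngle a b < ccwAngle a z := by
    have h1 := not_inSector_of_outer hp hr hT.hull_boundary (k := v) hc ho
    rw [hc.inSector_iff, not_and] at h1
    refine lt_of_le_of_ne (not_lt.1 (h1 hz0)) fun h2 => ?_
    obtain ⟨t, _, ht⟩ := eq_mul_of_ccwAngle_eq ha0 hb0 hz0 h2
    rw [ht, cross_mul, cross_self, mul_zero] at hbz0
    exact hbz0 rfl
  have haz : cross a z < 0 := by
    refine lt_of_le_of_ne (not_lt.1 fun h => ?_) haz0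
    rw [cross_pos_iff ha0 hz0] at h
    linarith
  have hbz : 0 < cross b z := by
    rw [cross_pos_iff hb0 hz0, ccwAngle_sub ha0 hb0 hz0 hge]
    have := ccwAngle_le a z
    linarith
  have hab : cross a b ≠ 0 := by
    refine hp.cross_ne_zero hc.1.ne' hc.2.1.ne' ?_
    rintro rfl
    linarith
  -- the scalar of the dilation
  set d := w i - w v with hd
  set ca := -cross a d / cross a z with hca
  set cb := -cross b d / cross b z with hcb
  -- These are the values of `c` at which `d + c z`, the value at `i` of the field `u` below,
  -- becomes parallel to `a`, respectively to `b`. If they agreed, this vector would be zero and `d`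
  -- parallel to `z`.
  have hcne : ca ≠ cb := by
    intro h
    have h1 : d + ca * z = 0 := by
      refine eq_zero_of_cross_eq_zero hab ?_ ?_
      · rw [cross_add, cross_mul, hca]; field_simp; ring
      · rw [h, cross_add, cross_mul, hcb]; field_simp; ring
    apply hne
    have h2 : d = (ca : ℝ) * (p i - p v) := by rw [hz] at h1; linear_combination h1
    rw [h2, cross_mul, cross_self, mul_zero]
  obtain ⟨c, hcmem, hcgen⟩ := exists_generic
    (fun q : {q : V × V // G.Adj q.1 q.2 ∧ q.1 ≠ v ∧ q.2 ≠ v} =>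
      cross (p q.1.2 - p q.1.1) (w q.1.1 - w v))
    (fun q => -cross (p q.1.2 - p q.1.1) (p q.1.1 - p v)) (fun q => Or.inr (by
      obtain ⟨⟨x, y⟩, hxy, hx, hy⟩ := q
      have h1 := hp.cross_ne_zero (v := x) hxy.ne' (Ne.symm hx) hy
      have h2 : p x - p v = -(p v - p x) := by ring
      simp only
      rw [h2, cross_neg, neg_neg]
      exact h1)) (Ioo_infinite (min_lt_max.2 hcne))
  have hcab : (c - ca) * (c - cb) < 0 := by
    rcases lt_or_gt_of_ne hcne with h | h
    · rw [min_eq_left h.le, max_eq_right h.le] at hcmem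
      exact mul_neg_of_pos_of_neg (by linarith [hcmem.1]) (by linarith [hcmem.2])
    · rw [min_eq_right h.le, max_eq_left h.le] at hcmem
      exact mul_neg_of_neg_of_pos (by linarith [hcmem.2]) (by linarith [hcmem.1])
  -- Removing a translation and a dilation leaves a parallel motion that vanishes at `v`. On edges
  -- at `v` its cross products are zero, so a perturbation can choose their signs; on the other
  -- edges they are nonzero by the choice of `c`.
  let u : V → ℂ := fun x => w x - w v - c * (p x - p v)
  have hu0 : ∀ x y, G.Adj x y → x ≠ v → y ≠ v → cross (p y - p x) (u x) ≠ 0 := by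
    intro x y hxy hx hy
    have := hcgen ⟨(x, y), hxy, hx, hy⟩
    simp only at this
    simp only [u]
    rw [cross_sub, cross_mul]
    convert this using 1
    ring
  have hueq : ∀ x y, G.Adj x y → ∀ δ, cross (p y - p x) (u x + δ) = cross (p y - p x) (u y + δ) := by
    intro x y hxy δ
    have h1 : u y + δ = (u x + δ) + ((w y - w x) + ((-c : ℝ) : ℂ) * (p y - p x)) := by
      simp only [u]; push_cast; ring
    rw [h1, cross_add _ (u x + δ), cross_add _ (w y - w x), cross_mul, hw x y hxy, cross_self]
    ring
  -- As `c` lies strictly between `ca` and `cb` and `v` is on opposite sides of the two edges, the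
  -- signs cancel: the reflex outer sector at `i` is counted.
  have hprod : 0 < cross a (u i) * cross b (u i) := by
    have h1 : u i = d + c * z := by simp only [u, hd, hz]; ring
    have h2 : cross a (u i) = (c - ca) * cross a z := by
      rw [h1, cross_add, cross_mul, hca]; field_simp; ring
    have h3 : cross b (u i) = (c - cb) * cross b z := by
      rw [h1, cross_add, cross_mul, hcb]; field_simp; ring
    rw [h2, h3]
    have h4 : (c - ca) * cross a z * ((c - cb) * cross b z) =
      ((c - ca) * (c - cb)) * (cross a z * cross b z) := by ring
    rw [h4]
    exact mul_pos_of_neg_of_neg hcab (mul_neg_of_neg_of_pos haz hbz)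
  -- the bounded face at `v`
  obtain ⟨x, hx⟩ := hT.exists_adj hvi
  have hxi : x ≠ i := by rintro rfl; exact hnadj hx
  obtain ⟨i₀, F, hi₀, hF, hFb, hFsub⟩ := exists_bounded_face hp hr hT.hull_boundary hx hvi hxi
  obtain ⟨n, q, hq, -⟩ := hT.exists_polygon ⟨F, hF, hFb⟩
  obtain ⟨j₀, hc₀⟩ := exists_areConsecutive (p := p) hi₀
  obtain ⟨m, hm, -⟩ := hq.exists_vertex hp hT.nonCrossing hr.1 hc₀ hFsub
  obtain ⟨i₁, hi₁, hF₁⟩ := hq.exists_sector hp hr (finRotate n m)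
  obtain ⟨i₂, hi₂, hF₂⟩ := hq.exists_sector hp hr ((finRotate n).symm m)
  have hadj₁ := hq.adj m
  have hadj₂ := hq.adj_symm m
  have hne₁₂ := hq.next_ne_prev m
  have hadj₁' := hq.adj (finRotate n m)
  have hadj₂' := hq.adj_symm ((finRotate n).symm m)
  have hne₁ : q (finRotate n (finRotate n m)) ≠ v := by
    have := hq.next_ne_prev (finRotate n m)
    rwa [Equiv.symm_apply_apply, hm] at this
  have hne₂ : q ((finRotate n).symm ((finRotate n).symm m)) ≠ v := by
    have := hq.next_ne_prev ((finRotate n).symm m)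
    rw [Equiv.apply_symm_apply, hm] at this
    exact this.symm
  have hcnt₁ := fun u' => hq.isCounted_iff hp hT.nonCrossing hr (u := u') _ hi₁ hF₁
  have hcnt₂ := fun u' => hq.isCounted_iff hp hT.nonCrossing hr (u := u') _ hi₂ hF₂
  rw [Equiv.symm_apply_apply] at hcnt₁
  rw [Equiv.apply_symm_apply] at hcnt₂
  rw [hm] at hadj₁ hadj₂ hcnt₁ hcnt₂
  generalize q (finRotate n (finRotate n m)) = a₂ at *
  generalize q ((finRotate n).symm ((finRotate n).symm m)) = b₂ at *
  generalize q (finRotate n m) = a₁ at *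
  generalize q ((finRotate n).symm m) = b₁ at *
  -- the perturbation
  set S₁ := cross (p a₂ - p a₁) (u a₁) with hS₁
  set S₂ := cross (p b₂ - p b₁) (u b₁) with hS₂
  have hS₁0 : S₁ ≠ 0 := hu0 _ _ hadj₁' hadj₁.ne' hne₁
  have hS₂0 : S₂ ≠ 0 := hu0 _ _ hadj₂' hadj₂.ne' hne₂
  -- The sign of `σ` is the one that `cross (p a₁ - p v) δ` must have for the sector at `a₁` to be
  -- counted after the perturbation; `τ` plays the same role at `b₁`. Both can be prescribed since
  -- the two edges at `v` are not parallel.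
  obtain ⟨σ, hσ0, hσ⟩ : ∃ σ : ℝ, σ ≠ 0 ∧ ((¬ IsReflex G p a₁ i₁ ∧ σ = S₁) ∨
      (IsReflex G p a₁ i₁ ∧ σ = -S₁)) := by
    by_cases h : IsReflex G p a₁ i₁
    · exact ⟨-S₁, neg_ne_zero.2 hS₁0, Or.inr ⟨h, rfl⟩⟩
    · exact ⟨S₁, hS₁0, Or.inl ⟨h, rfl⟩⟩
  obtain ⟨τ, hτ0, hτ⟩ : ∃ τ : ℝ, τ ≠ 0 ∧ ((¬ IsReflex G p b₁ i₂ ∧ τ = S₂) ∨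
      (IsReflex G p b₁ i₂ ∧ τ = -S₂)) := by
    by_cases h : IsReflex G p b₁ i₂
    · exact ⟨-S₂, neg_ne_zero.2 hS₂0, Or.inr ⟨h, rfl⟩⟩
    · exact ⟨S₂, hS₂0, Or.inl ⟨h, rfl⟩⟩
  obtain ⟨δ, hδ₁, hδ₂, hδ⟩ := exists_generic_vector
    (fun y : {y : V // G.Adj v y} => p y.1 - p v) (fun y => hp.sub_ne_zero y.2.ne')
    (hp.cross_ne_zero hadj₁.ne' hadj₂.ne' hne₁₂) hσ0 hτ0
  -- A small perturbation preserves the signs at all edges away from `v`, in particular at the edges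
  -- bounding the outer sector at `i`.
  have hsmall : ∀ᶠ t : ℝ in 𝓝[>] 0, ∀ x y, G.Adj x y ∧ x ≠ v ∧ y ≠ v →
      0 < cross (p y - p x) (u x) * cross (p y - p x) (u x + t * δ) := by
    refine eventually_all.2 fun x => eventually_all.2 fun y => ?_
    by_cases hxy : G.Adj x y ∧ x ≠ v ∧ y ≠ v
    · have h1 : Continuous fun t : ℝ =>
          cross (p y - p x) (u x) * cross (p y - p x) (u x + t * δ) :=
        continuous_const.mul ((continuous_cross _).comp (by fun_prop))
      have h2 := (h1.tendsto 0).mono_left (nhdsWithin_le_nhds (s := Ioi 0))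
      simp only [Complex.ofReal_zero, zero_mul, add_zero] at h2
      have h3 : 0 < cross (p y - p x) (u x) * cross (p y - p x) (u x) :=
        mul_self_pos.2 (hu0 x y hxy.1 hxy.2.1 hxy.2.2)
      filter_upwards [h2.eventually (lt_mem_nhds h3)] with t ht _ using ht
    · simp [hxy]
  obtain ⟨t, ht, ht0⟩ := (hsmall.and self_mem_nhdsWithin).exists
  replace ht0 : 0 < t := ht0
  let u' : V → ℂ := fun x => u x + t * δ
  have hu'v : u' v = t * δ := by simp [u', u]
  have hu' : IsTransversal G p u' := by
    intro x y hxy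
    refine ⟨hueq x y hxy _, ?_⟩
    by_cases hx : x = v
    · subst hx
      rw [hu'v, cross_mul]
      exact mul_ne_zero ht0.ne' (hδ ⟨y, hxy⟩)
    by_cases hy : y = v
    · subst hy
      rw [show cross (p y - p x) (u' x) = cross (p y - p x) (u' y) from hueq x y hxy _, hu'v,
        cross_mul, cross_sub_comm]
      exact mul_ne_zero ht0.ne' (neg_ne_zero.2 (hδ ⟨x, hxy.symm⟩))
    · exact right_ne_zero_of_mul (ht x y ⟨hxy, hx, hy⟩).ne'
  have hcross : ∀ y, G.Adj v y → cross (p v - p y) (u' y) = -(t * cross (p y - p v) δ) := by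
    intro y hy
    rw [show cross (p v - p y) (u' y) = cross (p v - p y) (u' v) from hueq y v hy.symm _, hu'v,
      cross_mul, cross_sub_comm]
    ring
  have hs₁ : 0 < S₁ * cross (p a₂ - p a₁) (u' a₁) := ht _ _ ⟨hadj₁', hadj₁.ne', hne₁⟩
  have hs₂ : 0 < S₂ * cross (p b₂ - p b₁) (u' b₁) := ht _ _ ⟨hadj₂', hadj₂.ne', hne₂⟩
  have hsign : ∀ {X S Y : ℝ}, 0 < S * Y → 0 < X * S → 0 < Y * (t * X) := by
    intro X S Y h1 h2
    have h3 : 0 < (S * Y) * (X * S) * t := by positivity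
    have h4 : (S * Y) * (X * S) * t = (Y * (t * X)) * S ^ 2 := by ring
    rw [h4] at h3
    exact pos_of_mul_pos_left h3 (sq_nonneg S)
  have hC₁ : IsCounted G p u' a₁ i₁ := by
    rw [hcnt₁, hcross a₁ hadj₁]
    rcases hσ with ⟨h1, rfl⟩ | ⟨h1, rfl⟩
    · refine Or.inl ⟨h1, ?_⟩
      have := hsign hs₁ hδ₁
      linarith
    · refine Or.inr ⟨h1, ?_⟩
      have := hsign (X := -cross (p a₁ - p v) δ) hs₁ (by linarith)
      linarith
  have hC₂ : IsCounted G p u' b₁ i₂ := by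
    rw [hcnt₂, hcross b₁ hadj₂]
    rcases hτ with ⟨h1, rfl⟩ | ⟨h1, rfl⟩
    · refine Or.inl ⟨h1, ?_⟩
      have := hsign hs₂ hδ₂
      linarith
    · refine Or.inr ⟨h1, ?_⟩
      have := hsign (X := -cross (p b₁ - p v) δ) hs₂ (by linarith)
      linarith
  have hC : IsCounted G p u' i j := by
    refine ⟨k, hc, Or.inr ⟨hpi, ?_⟩⟩
    have h1 : 0 < cross a (u i) * cross a (u' i) := ht i j ⟨hc.1, hvi, hjv⟩
    have h2 : 0 < cross b (u i) * cross b (u' i) := ht i k ⟨hc.2.1, hvi, hkv⟩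
    have h3 : 0 < (cross a (u i) * cross a (u' i)) * (cross b (u i) * cross b (u' i)) :=
      mul_pos h1 h2
    have h4 : (cross a (u i) * cross a (u' i)) * (cross b (u i) * cross b (u' i)) =
      (cross a (u i) * cross b (u i)) * (cross a (u' i) * cross b (u' i)) := by ring
    rw [h4] at h3
    exact pos_of_mul_pos_right h3 hprod.le
  exact false_of_isCounted hp hr hT hu' ⟨F, hF, hFb⟩ (d₁ := ⟨(a₁, i₁), hi₁⟩)
    (d₂ := ⟨(b₁, i₂), hi₂⟩) (fun h => hne₁₂ (congrArg (fun d : G.Dart => d.fst) h)) hF₁ hF₂ hC₁ hC₂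
    (d := ⟨(i, j), hc.1⟩) hC fun F' hF' => ho F'.1 F'.2.1 hF' F'.2.2

end PlaneFramework

namespace PlaneFramework

variable {V : Type*} {G : SimpleGraph V} {p : V → ℂ}

/-! ### Infinitesimal rigidity -/

lemma cross_neg_I_mul (a b : ℂ) : cross a (-Complex.I * b) = -inner ℝ a b := by
  simp [cross, Complex.inner]; ring

/-- The two extreme vertices in a generic direction are on the hull. The dilation factor `l` is read
off from them, and at any other vertex two non-parallel conditions leave only the value of that
dilation. -/
lemma isInfinitesimallyRigid [Fintype V] (hn : 2 ≤ Fintype.card V) (hp : InGeneralPosition p)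
    (hT : IsPseudoTriangulation G p) : IsInfinitesimallyRigid G p := by
  intro u hu
  have : Nontrivial V := Fintype.one_lt_card_iff_nontrivial.1 (by omega)
  let w : V → ℂ := fun i => -Complex.I * u i
  have hw : ∀ i j, G.Adj i j → cross (p j - p i) (w j - w i) = 0 := by
    intro i j hij
    have h1 : w j - w i = -Complex.I * (u j - u i) := by simp only [w]; ring
    rw [h1, cross_neg_I_mul, hu j i hij.symm, neg_zero]
  obtain ⟨e, he⟩ := exists_generic_direction hp
  have he0 : e ≠ 0 := by
    rintro rfl
    obtain ⟨i, j, hij⟩ := exists_pair_ne V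
    exact he i j hij (cross_zero _)
  obtain ⟨i₁, hi₁⟩ := Finite.exists_max fun v => cross e (p v)
  obtain ⟨i₂, hi₂⟩ := Finite.exists_min fun v => cross e (p v)
  have hne : i₁ ≠ i₂ := by
    rintro rfl
    obtain ⟨i, hi⟩ := exists_ne i₁
    apply he i i₁ hi
    rw [cross_comm, cross_sub, le_antisymm (hi₁ i) (hi₂ i), sub_self, neg_zero]
  have h1 : ∀ v, i₁ ≠ v → cross (p i₁ - p v) (w i₁ - w v) = 0 := fun v hv =>
    cross_eq_zero_of_hull hp hT hw hv he0 hi₁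
  have h2 : ∀ v, i₂ ≠ v → cross (p i₂ - p v) (w i₂ - w v) = 0 := fun v hv =>
    cross_eq_zero_of_hull hp hT hw hv (neg_ne_zero.2 he0)
      fun k => by rw [neg_cross, neg_cross]; linarith [hi₂ k]
  obtain ⟨l, hl⟩ := eq_real_mul_of_cross_eq_zero (hp.sub_ne_zero hne) (h1 i₂ hne)
  have key : ∀ v, w v = w i₁ + l * (p v - p i₁) := by
    intro v
    by_cases hv₁ : v = i₁
    · subst hv₁; simp
    by_cases hv₂ : v = i₂
    · subst hv₂; linear_combination -hl
    have h3 := hp.cross_ne_zero (Ne.symm hv₁) (Ne.symm hv₂) hne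
    have h4 : w v - (w i₁ + l * (p v - p i₁)) = 0 := by
      refine eq_zero_of_cross_eq_zero h3 ?_ ?_
      · have e1 : w v - (w i₁ + l * (p v - p i₁)) =
            l * (p i₁ - p v) - (w i₁ - w v) := by ring
        rw [e1, cross_sub, cross_mul, cross_self, h1 v (Ne.symm hv₁)]; ring
      · have e1 : w v - (w i₁ + l * (p v - p i₁)) =
            l * (p i₂ - p v) - (w i₂ - w v) := by linear_combination -hl
        rw [e1, cross_sub, cross_mul, cross_self, h2 v (Ne.symm hv₂)]; ring
    linear_combination h4
  refine ⟨Complex.I * (w i₁ - l * p i₁), l, fun v => ?_⟩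
  have h3 : u v = Complex.I * w v := by
    simp only [w]
    linear_combination (u v) * Complex.I_mul_I
  rw [h3, key v]
  ring

/-! ### Rigidity -/

lemma eq_zero_of_isTrivialMotion (hp : Function.Injective p) {u : V → ℂ}
    (h : IsTrivialMotion p u) {a b : V} (hab : a ≠ b) (ha : u a = 0) (hb : u b = 0) : u = 0 := by
  obtain ⟨c, s, hu⟩ := h
  have h1 : (s * Complex.I) * (p a - p b) = 0 := by
    rw [hu] at ha hb
    linear_combination ha - hb
  have h2 : (s : ℂ) * Complex.I = 0 :=
    (mul_eq_zero.1 h1).resolve_right (sub_ne_zero.2 fun e => hab (hp e))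
  have h3 : c = 0 := by
    rw [hu, h2] at ha
    simpa using ha
  ext i
  rw [hu, h2, h3]
  simp

open scoped Classical in
/-- The bilinear map whose partial maps, together with the values at two pinned vertices, are the
rigidity maps. -/
noncomputable def rigidityForm (G : SimpleGraph V) :
    (V → ℂ) →ₗ[ℝ] (V → ℂ) →ₗ[ℝ] ((V × V → ℝ) × ℂ × ℂ) :=
  LinearMap.mk₂ ℝ
    (fun q u => (fun e => if G.Adj e.1 e.2 then inner ℝ (q e.1 - q e.2) (u e.1 - u e.2) else 0,
      0, 0))
    (fun q q' u => by
      ext e <;> simp only [Prod.mk_add_mk, Pi.add_apply, add_zero]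
      split_ifs
      · rw [← inner_add_left]; congr 1; ring
      · simp)
    (fun c q u => by
      ext e <;> simp only [Prod.smul_mk, Pi.smul_apply, smul_zero]
      split_ifs
      · rw [← smul_sub, real_inner_smul_left]; rfl
      · simp)
    (fun q u u' => by
      ext e <;> simp only [Prod.mk_add_mk, Pi.add_apply, add_zero]
      split_ifs
      · rw [← inner_add_right]; congr 1; ring
      · simp)
    (fun c q u => by
      ext e <;> simp only [Prod.smul_mk, Pi.smul_apply, smul_zero]
      split_ifs
      · rw [← smul_sub, real_inner_smul_right]; rfl
      · simp)

/-- If `q` has the same edge lengths as `p`, then `q - p` is an infinitesimal motion of the midpoint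
realization, since `⟨x + y, x - y⟩ = ‖x‖² - ‖y‖²`. Injectivity of the pinned rigidity map is an open
condition, so it persists at the midpoint for `q` near `p` and forces `q = p`. -/
lemma isRigid_of_isInfinitesimallyRigid [Fintype V] (hp : Function.Injective p)
    (h : IsInfinitesimallyRigid G p) (hG : ∃ a b, G.Adj a b) : IsRigid G p := by
  classical
  refine ⟨hG, fun a b hab => ?_⟩
  let pin : (V → ℂ) →L[ℝ] ((V × V → ℝ) × ℂ × ℂ) :=
    (0 : (V → ℂ) →L[ℝ] (V × V → ℝ)).prod
      ((ContinuousLinearMap.proj a).prod (ContinuousLinearMap.proj b))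
  let A : (V → ℂ) → (V → ℂ) →L[ℝ] ((V × V → ℝ) × ℂ × ℂ) := fun q =>
    (LinearMap.toContinuousLinearMap.toLinearMap ∘ₗ rigidityForm G) q + pin
  have hA : ∀ q u, A q u = 0 ↔
      (∀ i j, G.Adj i j → inner ℝ (q i - q j) (u i - u j) = 0) ∧ u a = 0 ∧ u b = 0 := by
    intro q u
    have : A q u = (fun e => if G.Adj e.1 e.2 then inner ℝ (q e.1 - q e.2) (u e.1 - u e.2) else 0,
        u a, u b) := by
      simp only [A, pin, rigidityForm]
      ext <;> simp [-Complex.inner]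
    rw [this, Prod.mk_eq_zero, Prod.mk_eq_zero]
    refine and_congr_left fun _ => ?_
    rw [funext_iff, Prod.forall]
    refine forall_congr' fun i => forall_congr' fun j => ?_
    by_cases hij : G.Adj i j <;> simp only [hij, if_true, if_false, Pi.zero_apply, true_imp_iff,
      false_imp_iff]
  have hcont : Continuous A :=
    (LinearMap.continuous_of_finiteDimensional _).add continuous_const
  have hinj : Function.Injective (A p) := by
    rw [injective_iff_map_eq_zero]
    intro u hu
    obtain ⟨h1, h2, h3⟩ := (hA p u).1 hu
    exact eq_zero_of_isTrivialMotion hp (h u h1) hab.ne h2 h3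
  have hmid : Continuous fun q : V → ℂ => A ((1 / 2 : ℝ) • (p + q)) := hcont.comp (by fun_prop)
  have hopen := ContinuousLinearMap.isOpen_injective.preimage hmid
  have hmem : p ∈ (fun q : V → ℂ => A ((1 / 2 : ℝ) • (p + q))) ⁻¹'
      {L | Function.Injective L} := by
    have : (1 / 2 : ℝ) • (p + p) = p := by
      rw [← two_smul ℝ p, smul_smul]; norm_num
    simp only [mem_preimage, mem_ofPred_eq, this]
    exact hinj
  filter_upwards [hopen.mem_nhds hmem] with q hq hqc
  obtain ⟨hlen, hqa, hqb⟩ := hqc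
  have h0 : A ((1 / 2 : ℝ) • (p + q)) (q - p) = 0 := by
    rw [hA]
    refine ⟨fun i j hij => ?_, by simp [hqa], by simp [hqb]⟩
    have h1 := hlen i j hij
    rw [dist_eq_norm, dist_eq_norm] at h1
    have h2 : inner ℝ ((q i - q j) + (p i - p j)) ((q i - q j) - (p i - p j)) = 0 :=
      (real_inner_add_sub_eq_zero_iff _ _).2 h1
    have h3 : ((1 / 2 : ℝ) • (p + q)) i - ((1 / 2 : ℝ) • (p + q)) j =
        (1 / 2 : ℝ) • ((q i - q j) + (p i - p j)) := by
      simp only [Pi.smul_apply, Pi.add_apply, ← smul_sub]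
      congr 1; ring
    have h4 : (q - p) i - (q - p) j = (q i - q j) - (p i - p j) := by
      simp only [Pi.sub_apply]; ring
    rw [h3, h4, real_inner_smul_left, h2, mul_zero]
  have hq' : Function.Injective (A ((1 / 2 : ℝ) • (p + q))) := hq
  exact sub_eq_zero.1 ((injective_iff_map_eq_zero _).1 hq' _ h0)

/-! ### Minimality -/

/-- The rigidity map goes from dimension `2n` to dimension `e`, and its kernel lies in the image of
the three parameters of the trivial motions. -/
lemma card_edgeSet_of_isInfinitesimallyRigid [Fintype V] [Fintype G.edgeSet]
    (h : IsInfinitesimallyRigid G p) :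
    2 * Fintype.card V ≤ Fintype.card G.edgeSet + 3 := by
  let R : (V → ℂ) →ₗ[ℝ] (G.edgeSet → ℝ) :=
    { toFun := fun u e => inner ℝ (p e.1.out.1 - p e.1.out.2) (u e.1.out.1 - u e.1.out.2)
      map_add' := by
        intro u u'
        ext e
        simp only [Pi.add_apply]
        rw [← inner_add_right]; congr 1; ring
      map_smul' := by
        intro c u
        ext e
        simp only [Pi.smul_apply, RingHom.id_apply]
        rw [← smul_sub, real_inner_smul_right]; rfl }
  let S : ℂ × ℝ →ₗ[ℝ] (V → ℂ) :=
    { toFun := fun q i => q.1 + q.2 * Complex.I * p i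
      map_add' := by
        intro q q'
        ext i
        simp only [Prod.fst_add, Prod.snd_add, Pi.add_apply]
        push_cast; ring
      map_smul' := by
        intro c q
        ext i
        simp only [Prod.smul_fst, Prod.smul_snd, Pi.smul_apply, RingHom.id_apply,
          Complex.real_smul, smul_eq_mul]
        push_cast; ring }
  have hker : LinearMap.ker R ≤ LinearMap.range S := by
    intro u hu
    obtain ⟨a, s, hus⟩ := h u (by
      intro i j hij
      have h1 : inner ℝ (p s(i, j).out.1 - p s(i, j).out.2)
          (u s(i, j).out.1 - u s(i, j).out.2) = 0 :=
        congrFun (LinearMap.mem_ker.1 hu) ⟨s(i, j), hij⟩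
      have h2 : s(s(i, j).out.1, s(i, j).out.2) = s(i, j) := Quot.out_eq _
      rw [Sym2.eq_iff] at h2
      rcases h2 with ⟨e1, e2⟩ | ⟨e1, e2⟩
      · rwa [e1, e2] at h1
      · rw [e1, e2] at h1
        rw [← neg_sub (p j), ← neg_sub (u j), inner_neg_neg]
        exact h1)
    exact ⟨(a, s), funext fun i => (hus i).symm⟩
  have h1 := LinearMap.finrank_range_add_finrank_ker R
  have h2 := Submodule.finrank_le (LinearMap.range R)
  have h3 := Submodule.finrank_mono hker
  have h4 := LinearMap.finrank_range_le S
  have h5 : Module.finrank ℝ (V → ℂ) = 2 * Fintype.card V := by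
    rw [Module.finrank_pi_fintype]
    simp [Complex.finrank_real_complex, mul_comm]
  simp only [Module.finrank_prod, Module.finrank_pi, Module.finrank_self,
    Complex.finrank_real_complex] at h1 h2 h4
  omega

open scoped Classical in
lemma isMinimallyInfinitesimallyRigid [Fintype V] (hn : 2 ≤ Fintype.card V)
    (hp : InGeneralPosition p) (hT : IsPseudoTriangulation G p) (hpt : ∀ v, IsPointedAt G p v) :
    IsMinimallyInfinitesimallyRigid G p := by
  refine ⟨isInfinitesimallyRigid hn hp hT, fun e he h => ?_⟩
  have h1 := card_edgeSet_of_isInfinitesimallyRigid h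
  have h2 := card_edgeSet_add_three_le hn hp hT hpt
  have h3 : Fintype.card (G.deleteEdges {e}).edgeSet < Fintype.card G.edgeSet := by
    refine Set.card_lt_card ?_
    rw [SimpleGraph.edgeSet_deleteEdges]
    exact ⟨sdiff_subset, fun h => (h he).2 rfl⟩
  omega

end PlaneFramework

theorem mainTheorem6 {V : Type*} [Fintype V] (hn : 2 ≤ Fintype.card V)
    (G : SimpleGraph V) (p : V → ℂ) (hp : PlaneFramework.InGeneralPosition p)
    (hT : PlaneFramework.IsPseudoTriangulation G p) :
    PlaneFramework.IsInfinitesimallyRigid G p ∧ PlaneFramework.IsRigid G p ∧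
      ((∀ v : V, PlaneFramework.IsPointedAt G p v) →
        PlaneFramework.IsMinimallyInfinitesimallyRigid G p) := by
  have hrig := PlaneFramework.isInfinitesimallyRigid hn hp hT
  have : Nontrivial V := Fintype.one_lt_card_iff_nontrivial.1 (by omega)
  obtain ⟨a, b, hab⟩ := exists_pair_ne V
  exact ⟨hrig, PlaneFramework.isRigid_of_isInfinitesimallyRigid hp.1 hrig
    ⟨a, hT.exists_adj hab.symm⟩, PlaneFramework.isMinimallyInfinitesimallyRigid hn hp hT⟩
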